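/- Let $\varphi_k(t)=\sqrt{k+1/2}\,(2^kk!)^{-1}\frac{d^k}{dt^k}(t^2-1)^k$, $k=0,1,2,\dots$, be the orthonormal Legendre polynomials on $[-1,1]$, let $Q=[-1,1]^2$, and for $f\in L_2(Q)$ let $\langle f,\varphi_{k,j}\rangle=\int_Q f(t,\tau)\varphi_k(t)\varphi_j(\tau)\,d\tau\,dt$. For $\mu>0$, $1\le s<\infty$ put $$\|f\|_{s,\mu}^s=\sum_{k,j\ge 0}\big(\max\{1,k\}\max\{1,j\}\big)^{s\mu}|\langle f,\varphi_{k,j}\rangle|^s .$$ For integers $r_1,r_2\ge 1$ let $f^{(r_1,r_2)}=\sum_{k\ge r_1,\,j\ge r_2}\langle f,\varphi_{k,j}\rangle\,\varphi_k^{(r_1)}(t)\,\varphi_j^{(r_2)}(\tau)$, the series being taken in $L_2(Q)$. For a double sequence $y=(y_{k,j})_{k,j\ge0}$ of real numbers, $n>0$ and $\gamma\ge1$, let $$\mathcal D^{(r_1,r_2)}_{n,\gamma}y(t,\tau)=\sum_{k\ge r_1,\ j\ge r_2,\ k j^\gamma\le n} y_{k,j}\,\varphi_k^{(r_1)}(t)\,\varphi_j^{(r_2)}(\tau).$$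 **Theorem.** Let $1\le s<\infty$, $1\le p\le\infty$ (with $1/p=0$ for $p=\infty$), let $r_1\ge r_2\ge1$ be integers, and let $\mu>2r_1+\frac12-\frac1s$. Put $$E=\mu-\tfrac1p+\tfrac1s,\qquad \alpha_1=\mu-2r_1+\tfrac1s-\tfrac12,\qquad \alpha_2=\mu-2r_2+\tfrac1s-\tfrac12 .$$ Then the series $f^{(r_1,r_2)}$ converges in $L_2(Q)$ for every $f$ with $\|f\|_{s,\mu}\le1$, and in each of the cases below $$\|f^{(r_1,r_2)}-\mathcal D^{(r_1,r_2)}_{n,\gamma}y\|_{L_2(Q)}\le c\,\varepsilon(\delta)\qquad\text{whenever } n\asymp\nu(\delta),$$ for all $f$ with $\|f\|_{s,\mu}\le1$ and all $y$ with $\big\|(\langle f,\varphi_{k,j}\rangle-y_{k,j})_{k,j\ge0}\big\|_{\ell_p}\le\delta$. I) If $r_1=r_2$ and $\gamma=1$: $$\nu(\delta)=\Big(\delta/\ln^{\frac1p-\frac1s}\tfrac1\delta\Big)^{-1/E},\qquad \varepsilon(\delta)=\Big(\delta\ln^{\frac1s-\frac1p}\tfrac1\delta\Big)^{\alpha_1/E}\ln^{\frac32-\frac1s}\tfrac1\delta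 .$$ II) If $r_1>r_2$: a) for $\gamma\in\big[1,\frac{\alpha_2}{\alpha_1+1}\big)\cup\big(\frac{\alpha_2}{\alpha_1+1},\frac{\alpha_2+1}{\alpha_1+1}\big)\cup\big(\frac{\alpha_2+1}{\alpha_1+1},\frac{\alpha_2}{\alpha_1}\big)$: $\ \nu(\delta)=\delta^{-1/E}$, $\ \varepsilon(\delta)=\delta^{\alpha_1/E}$; b) for $\gamma=\frac{\alpha_2}{\alpha_1+1}$ and for $\gamma=\frac{\alpha_2}{\alpha_1}$: $\ \nu(\delta)=\delta^{-1/E}\ln^{\frac1{2E}}\frac1\delta$, $\ \varepsilon(\delta)=\big(\delta/\ln^{1/2}\frac1\delta\big)^{\alpha_1/E}\ln^{1/2}\frac1\delta$; c) for $\gamma=\frac{\alpha_2+1}{\alpha_1+1}$: $\ \nu(\delta)=\big(\delta/\ln^{1-\frac1s}\frac1\delta\big)^{-1/E}$, $\ \varepsilon(\delta)=\big(\delta/\ln^{1-\frac1s}\frac1\delta\big)^{\alpha_1/E}\ln^{1-\frac1s}\frac1\delta$. Here $n\asymp\nu(\delta)$ means $A\nu(\delta)\le n\le B\nu(\delta)$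 with arbitrary fixed $0<A\le B$. The range of $\delta$ is $0<\delta<1$ in case II a), and $0<\delta<\delta_0$ with an arbitrary fixed $\delta_0<1$ in cases I, II b), II c). The constant $c$ depends only on $r_1,r_2,s,\mu,p,\gamma,A,B$ (and $\delta_0$), not on $\delta,n,f,y$. -/

import Mathlib

open MeasureTheory
open scoped ENNReal

namespace LegendreTruncation

/-- The orthonormal Legendre polynomial on `[-1,1]`, by Rodrigues' formula:
`φ_k(t) = √(k + 1/2) (2^k k!)⁻¹ (d/dt)^k (t² - 1)^k`. -/
noncomputable def legendre (k : ℕ) : Polynomial ℝ :=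
  Polynomial.C (Real.sqrt ((k : ℝ) + 1 / 2) * ((2 : ℝ) ^ k * (k.factorial : ℝ))⁻¹) *
    Polynomial.derivative^[k] ((Polynomial.X ^ 2 - 1) ^ k)

/-- The square `Q = [-1,1]²`. -/
def Q : Set (ℝ × ℝ) := Set.Icc (-1) 1 ×ˢ Set.Icc (-1) 1

/-- Lebesgue measure on `Q`. -/
noncomputable def volQ : Measure (ℝ × ℝ) := volume.restrict Q

/-- The space `L₂(Q)` of real square-integrable functions on `Q`, with its norm. -/
abbrev L2Q : Type := Lp ℝ 2 volQ

/-- The Fourier-Legendre coefficient `⟨f, φ_{k,j}⟩`. -/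
noncomputable def coeff (f : L2Q) (k j : ℕ) : ℝ :=
  ∫ z, f z * ((legendre k).eval z.1 * (legendre j).eval z.2) ∂volQ

/-- The terms `(max{1,k} max{1,j})^{sμ} |⟨f, φ_{k,j}⟩|^s` of `‖f‖_{s,μ}^s`. -/
noncomputable def smoothnessTerm (s μ : ℝ) (f : L2Q) (kj : ℕ × ℕ) : ℝ :=
  (((max 1 kj.1 * max 1 kj.2 : ℕ) : ℝ)) ^ (s * μ) * |coeff f kj.1 kj.2| ^ s

/-- The unit ball of `L^μ_{s,2}(Q)`: the functions with `‖f‖_{s,μ} < ∞` and `‖f‖_{s,μ} ≤ 1`. -/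
def unitBall (s μ : ℝ) : Set L2Q :=
  {f | Summable (smoothnessTerm s μ f) ∧ (∑' kj, smoothnessTerm s μ f kj) ^ (1 / s) ≤ 1}

/-- The function `(t, τ) ↦ φ_k^{(r₁)}(t) φ_j^{(r₂)}(τ)`. -/
noncomputable def derivProdFun (r₁ r₂ k j : ℕ) (z : ℝ × ℝ) : ℝ :=
  (Polynomial.derivative^[r₁] (legendre k)).eval z.1 *
    (Polynomial.derivative^[r₂] (legendre j)).eval z.2

theorem memLp_derivProdFun (r₁ r₂ k j : ℕ) : MemLp (derivProdFun r₁ r₂ k j) 2 volQ := by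
  have hc : Continuous (derivProdFun r₁ r₂ k j) := by
    unfold derivProdFun
    fun_prop
  have hQ : IsCompact Q := isCompact_Icc.prod isCompact_Icc
  obtain ⟨C, hC⟩ := hQ.exists_bound_of_continuousOn hc.continuousOn
  have : IsFiniteMeasure volQ := ⟨by
    rw [volQ, Measure.restrict_apply_univ]
    exact hQ.measure_lt_top⟩
  refine MemLp.of_bound hc.aestronglyMeasurable C ?_
  exact (ae_restrict_iff' hQ.measurableSet).2 (Filter.Eventually.of_forall hC)

/-- `φ_k^{(r₁)} ⊗ φ_j^{(r₂)}` as an element of `L₂(Q)`. -/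
noncomputable def derivProd (r₁ r₂ k j : ℕ) : L2Q := (memLp_derivProdFun r₁ r₂ k j).toLp

/-- The terms of the series for the mixed derivative of `f`, indexed by the pairs
`(k, j)` (those with `k < r₁` or `j < r₂` vanish, because `φ_k` has degree `k`). -/
noncomputable def mixedDerivTerm (r₁ r₂ : ℕ) (f : L2Q) (kj : ℕ × ℕ) : L2Q :=
  coeff f kj.1 kj.2 • derivProd r₁ r₂ kj.1 kj.2

/-- The mixed derivative
`f^{(r₁,r₂)} = ∑_{k,j} ⟨f, φ_{k,j}⟩ φ_k^{(r₁)} φ_j^{(r₂)}`, the series being taken in `L₂(Q)`. -/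
noncomputable def mixedDeriv (r₁ r₂ : ℕ) (f : L2Q) : L2Q :=
  ∑' kj, mixedDerivTerm r₁ r₂ f kj

/-- The perturbed coefficients `y` of `f` have error level `δ` in `ℓ_p`:
`‖(⟨f, φ_{k,j}⟩ - y_{k,j})_{k,j}‖_{ℓ_p} ≤ δ`. -/
def IsPerturbation (p : ℝ≥0∞) (δ : ℝ) (f : L2Q) (y : ℕ × ℕ → ℝ) : Prop :=
  ∃ ξ : lp (fun _ : ℕ × ℕ => ℝ) p,
    (∀ kj : ℕ × ℕ, ξ kj = coeff f kj.1 kj.2 - y kj) ∧ ‖ξ‖ ≤ δ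

/-- The hyperbolic cross `Γ_{n,γ}` in `[r₁,∞) × [r₂,∞)`: the pairs with `k j^γ ≤ n`,
`r₁ ≤ k ≤ n / r₂^γ` and `r₂ ≤ j ≤ (n / r₁)^{1/γ}`. -/
noncomputable def cross (r₁ r₂ : ℕ) (n γ : ℝ) : Finset (ℕ × ℕ) := by
  classical
  exact (Finset.Icc r₁ ⌊n / (r₂ : ℝ) ^ γ⌋₊ ×ˢ Finset.Icc r₂ ⌊(n / (r₁ : ℝ)) ^ (1 / γ)⌋₊).filter
    fun kj => (kj.1 : ℝ) * (kj.2 : ℝ) ^ γ ≤ n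

/-- The truncation method `D^{(r₁,r₂)}_{n,γ}` applied to the perturbed coefficients `y`. -/
noncomputable def truncation (r₁ r₂ : ℕ) (n γ : ℝ) (y : ℕ × ℕ → ℝ) : L2Q :=
  ∑ kj ∈ cross r₁ r₂ n γ, y kj • derivProd r₁ r₂ kj.1 kj.2

/-- For `n ≍ ν(δ)`, the error of `D^{(r₁,r₂)}_{n,γ}` on the unit ball of `L^μ_{s,2}` is
at most `c ε(δ)` for all `0 < δ < δ₀`. The constant `c` depends on `δ₀` and on the two
constants in `n ≍ ν(δ)` (and on the parameters), but not on `δ`, `n`, `f` or the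
perturbed coefficients `y`. -/
def ErrorEstimate (r₁ r₂ : ℕ) (s μ : ℝ) (p : ℝ≥0∞) (γ δ₀ : ℝ) (ν ε : ℝ → ℝ) : Prop :=
  ∀ A B : ℝ, 0 < A → A ≤ B → ∃ c : ℝ, 0 < c ∧
    ∀ δ : ℝ, 0 < δ → δ < δ₀ →
    ∀ n : ℝ, A * ν δ ≤ n → n ≤ B * ν δ →
    ∀ f ∈ unitBall s μ, ∀ y : ℕ × ℕ → ℝ, IsPerturbation p δ f y →
      ‖mixedDeriv r₁ r₂ f - truncation r₁ r₂ n γ y‖ ≤ c * ε δ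

end LegendreTruncation

open LegendreTruncation

/-!
The proof rests on the almost orthogonality of the derivatives `φ_k^{(r)}` between dyadic blocks of
frequencies. Repeated integration by parts of `∫ φ_k^{(r)} φ_{k'}^{(r)}`, `k ≤ k'`, leaves only
boundary terms with fewer than `r` derivatives moved, and the endpoint values
`|φ_k^{(m)}(±1)| ≲ k^{2m+1/2}` bound them by `(k k')^{2r-1/2} (k/k')` (`abs_gram_le`). Schur's test
(`norm_sum_smul_sq_le`) then gives
`‖∑ a_{k,j} φ_k^{(r₁)} φ_j^{(r₂)}‖² ≲ ∑_{(a,b)} (∑_{(k,j) in block (a,b)}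
|a_{k,j}| k^{2r₁-1/2} j^{2r₂-1/2})²`,
so that the triangle inequality is only used inside the blocks. Neither the orthonormality nor the
completeness of the Legendre system is needed.

Inside a block of `2^{a+b}` indices Hölder's inequality bounds the sum by `2^{-aα₁-bα₂}` for
a function of the unit ball, and by `δ 2^{aβ₁+bβ₂}`, `β_i = 2r_i + 1/2 - 1/p`, for the noise
(`norm_sum_derivProd_sq_le`). The squares are summed as geometric series over the blocks outside
and inside the hyperbolic cross. With `1 + ln⁺ n` written `Λ`, this gives (for `γ α₁ ≤ α₂` and
`β₂ ≤ γ β₁`) an error of at most a constant times `n^{-α₁} Λ^{κ/2} + δ n^{β₁} Λ^{κ'/2}`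
(`norm_mixedDeriv_sub_truncation_le`), where `κ = 1` if `γ α₁ = α₂`, `κ' = 1` if `β₂ = γ β₁`, and
both vanish otherwise. As `E = α₁ + β₁`, the choice `n ≍ ν(δ)` balances the two terms up to
logarithms. The powers of the logarithm that arise never exceed those in the claimed
bounds; for `r₁ = r₂` this uses `1/2 ≤ 3/2 - 1/s` and `1/p ≤ 1`.
-/

namespace LegendreTruncation

/-! ### Almost orthogonality of derivatives of Legendre polynomials -/

section

open Polynomial

/-- Repeated integration by parts for polynomials on `[-1,1]`, with all the boundary terms. -/
theorem integral_mul_iterate_derivative (N : ℕ) (f g : ℝ[X]) :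
    ∫ x in (-1 : ℝ)..1, f.eval x * (derivative^[N] g).eval x =
      ∑ i ∈ Finset.range N, (-1) ^ i *
        ((derivative^[i] f).eval 1 * (derivative^[N - 1 - i] g).eval 1 -
          (derivative^[i] f).eval (-1) * (derivative^[N - 1 - i] g).eval (-1)) +
      (-1) ^ N * ∫ x in (-1 : ℝ)..1, (derivative^[N] f).eval x * g.eval x := by
  induction N generalizing f with
  | zero => simp
  | succ N ih =>
    have h := intervalIntegral.integral_mul_deriv_eq_deriv_mul (a := (-1 : ℝ)) (b := 1)
      (u := fun x => f.eval x) (v := fun x => (derivative^[N] g).eval x)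
      (u' := fun x => (derivative f).eval x) (v' := fun x => (derivative^[N + 1] g).eval x)
      (fun x _ => f.hasDerivAt x)
      (fun x _ => by
        rw [Function.iterate_succ_apply']
        exact (derivative^[N] g).hasDerivAt x)
      ((derivative f).continuous.intervalIntegrable _ _)
      ((derivative^[N + 1] g).continuous.intervalIntegrable _ _)
    rw [h, ih, Finset.sum_range_succ']
    have hs : ∑ i ∈ Finset.range N, (-1 : ℝ) ^ (i + 1) *
        ((derivative^[i + 1] f).eval 1 * (derivative^[N + 1 - 1 - (i + 1)] g).eval 1 -
          (derivative^[i + 1] f).eval (-1) *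
            (derivative^[N + 1 - 1 - (i + 1)] g).eval (-1)) =
        - ∑ i ∈ Finset.range N, (-1 : ℝ) ^ i *
        ((derivative^[i] (derivative f)).eval 1 * (derivative^[N - 1 - i] g).eval 1 -
          (derivative^[i] (derivative f)).eval (-1) *
            (derivative^[N - 1 - i] g).eval (-1)) := by
      rw [← Finset.sum_neg_distrib]
      refine Finset.sum_congr rfl fun i _ => ?_
      rw [show N + 1 - 1 - (i + 1) = N - 1 - i by omega, Function.iterate_succ_apply]
      ring
    rw [hs]
    simp only [pow_zero, Function.iterate_zero, id, Nat.add_sub_cancel, Nat.sub_zero,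
      ← Function.iterate_succ_apply, pow_succ]
    ring

/-- At the endpoints `a = ±1` only one term of the Leibniz formula for
`(X² - 1)^k = (X - a)^k (X + a)^k` survives. -/
theorem eval_iterate_derivative_sq_sub_one_pow {a : ℝ} (ha : a ^ 2 = 1) (k m : ℕ) :
    (derivative^[k + m] ((X ^ 2 - 1 : ℝ[X]) ^ k)).eval a =
      (k + m).choose m * (k.factorial * (k.descFactorial m * (2 * a) ^ (k - m))) := by
  have hfac : (X ^ 2 - 1 : ℝ[X]) ^ k = (X - C a) ^ k * (X + C a) ^ k := by
    rw [← mul_pow]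
    congr 1
    have : (C a : ℝ[X]) ^ 2 = 1 := by rw [← C_pow, ha, C_1]
    linear_combination this
  rw [hfac, iterate_derivative_mul, eval_finsetSum, Finset.sum_eq_single m]
  · rw [show k + m - m = k by omega]
    simp [iterate_derivative_X_sub_pow, iterate_derivative_X_add_pow, Nat.descFactorial_self,
      two_mul]
  · intro i hi him
    have hi' : i ≤ k + m := Nat.lt_succ_iff.1 (Finset.mem_range.1 hi)
    rw [iterate_derivative_X_sub_pow, iterate_derivative_X_add_pow]
    rcases lt_or_gt_of_ne him with h | h
    · rw [Nat.descFactorial_of_lt (by omega)]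
      simp
    · have : k - (k + m - i) ≠ 0 := by omega
      simp [this]
  · intro h
    exact absurd (Finset.mem_range.2 (by omega)) h

theorem eval_iterate_derivative_sq_sub_one_pow_of_lt {a : ℝ} (ha : a ^ 2 = 1) {k m : ℕ}
    (h : m < k) : (derivative^[m] ((X ^ 2 - 1 : ℝ[X]) ^ k)).eval a = 0 := by
  have hd := pow_sub_dvd_iterate_derivative_pow (X ^ 2 - 1 : ℝ[X]) k m
  obtain ⟨q, hq⟩ := hd
  rw [hq, eval_mul, eval_pow]
  simp [ha, Nat.sub_ne_zero_of_lt h]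

theorem abs_eval_iterate_derivative_le {a : ℝ} (ha : a ^ 2 = 1) {k : ℕ} (hk : 1 ≤ k) (m : ℕ) :
    |(derivative^[k + m] ((X ^ 2 - 1 : ℝ[X]) ^ k)).eval a| ≤
      (2 ^ k * k.factorial) * ((1 + m) ^ m * (k : ℝ) ^ (2 * m)) := by
  have ha1 : |a| = 1 := by
    rw [← sq_eq_sq₀ (abs_nonneg a) zero_le_one, sq_abs, ha, one_pow]
  rw [eval_iterate_derivative_sq_sub_one_pow ha]
  simp only [abs_mul, abs_pow, Nat.abs_cast, ha1, mul_one, Nat.abs_ofNat]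
  have hk1 : (1 : ℝ) ≤ k := by exact_mod_cast hk
  have h1 : ((k + m).choose m : ℝ) ≤ (1 + m) ^ m * (k : ℝ) ^ m := by
    calc ((k + m).choose m : ℝ) ≤ ((k + m) ^ m : ℕ) := by
          exact_mod_cast Nat.choose_le_pow _ _
      _ ≤ ((1 + m) * k : ℝ) ^ m := by
          push_cast
          gcongr
          nlinarith [(Nat.cast_nonneg m : (0 : ℝ) ≤ m)]
      _ = _ := mul_pow _ _ _
  have h2 : (k.descFactorial m : ℝ) ≤ (k : ℝ) ^ m := by
    exact_mod_cast Nat.descFactorial_le_pow k m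
  have h3 : (2 : ℝ) ^ (k - m) ≤ 2 ^ k := pow_le_pow_right₀ one_le_two (Nat.sub_le _ _)
  calc ((k + m).choose m : ℝ) * (k.factorial * (k.descFactorial m * 2 ^ (k - m)))
      ≤ ((1 + m) ^ m * (k : ℝ) ^ m) * (k.factorial * ((k : ℝ) ^ m * 2 ^ k)) := by gcongr
    _ = _ := by ring

/-- The Gram matrix of the `r`-th derivatives of the Legendre polynomials. -/
noncomputable def gram (r k k' : ℕ) : ℝ :=
  ∫ x in (-1 : ℝ)..1, (derivative^[r] (legendre k)).eval x * (derivative^[r] (legendre k')).eval x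

theorem gram_comm (r k k' : ℕ) : gram r k k' = gram r k' k := by
  simp only [gram, mul_comm]

/-- The normalising factor in Rodrigues' formula. -/
noncomputable def rodriguesFactor (k : ℕ) : ℝ :=
  Real.sqrt ((k : ℝ) + 1 / 2) * ((2 : ℝ) ^ k * (k.factorial : ℝ))⁻¹

theorem iterate_derivative_legendre (r k : ℕ) :
    derivative^[r] (legendre k) =
      C (rodriguesFactor k) * derivative^[k + r] ((X ^ 2 - 1 : ℝ[X]) ^ k) := by
  rw [legendre, iterate_derivative_C_mul, ← Function.iterate_add_apply, Nat.add_comm r k]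
  rfl

theorem natDegree_sq_sub_one_pow (k : ℕ) : ((X ^ 2 - 1 : ℝ[X]) ^ k).natDegree = 2 * k := by
  rw [natDegree_pow, show (X ^ 2 - 1 : ℝ[X]) = X ^ 2 - C 1 by simp, natDegree_X_pow_sub_C,
    mul_comm]

theorem derivative_legendre_eq_zero {r k : ℕ} (h : k < r) :
    derivative^[r] (legendre k) = 0 := by
  rw [iterate_derivative_legendre, iterate_derivative_eq_zero, mul_zero]
  rw [natDegree_sq_sub_one_pow]
  omega

/-- Moving all the derivatives onto the factor of lower degree kills the integral; of the boundary
terms only those with fewer than `r` derivatives moved survive, the polynomial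
`(X² - 1)^k'` vanishing to order `k'` at `±1`. -/
theorem abs_gram_le_of_le {r : ℕ} (hr : 1 ≤ r) :
    ∃ C : ℝ, 0 < C ∧ ∀ k k' : ℕ, 1 ≤ k → k ≤ k' →
      |gram r k k'| ≤ C * (Real.sqrt k * Real.sqrt k') * ((k : ℝ) ^ (2 * r) *
        (k' : ℝ) ^ (2 * r - 2)) := by
  set M : ℝ := (1 + 2 * r) ^ (2 * r) with hM
  have hM1 : 0 < M := by positivity
  have hr' : (1 : ℝ) ≤ r := by exact_mod_cast hr
  refine ⟨2 * (r * (2 * M ^ 2)), by positivity, fun k k' hk hkk' => ?_⟩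
  have hk' : 1 ≤ k' := hk.trans hkk'
  set u := (X ^ 2 - 1 : ℝ[X]) ^ k with hu
  set v := (X ^ 2 - 1 : ℝ[X]) ^ k' with hv
  have hG : gram r k k' = rodriguesFactor k * rodriguesFactor k' *
      ∫ x in (-1 : ℝ)..1, (derivative^[k + r] u).eval x * (derivative^[k' + r] v).eval x := by
    rw [gram, ← intervalIntegral.integral_const_mul]
    congr 1
    ext x
    rw [iterate_derivative_legendre, iterate_derivative_legendre, eval_mul, eval_mul, eval_C,
      eval_C]
    ring
  have hzero : derivative^[k' + r] (derivative^[k + r] u) = 0 := by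
    rw [← Function.iterate_add_apply]
    apply iterate_derivative_eq_zero
    rw [hu, natDegree_sq_sub_one_pow]
    omega
  rw [integral_mul_iterate_derivative, hzero] at hG
  simp only [eval_zero, zero_mul, intervalIntegral.integral_zero, mul_zero, add_zero] at hG
  set F : ℝ := (2 ^ k * k.factorial) * (2 ^ k' * k'.factorial) with hF
  have hbd : ∀ a : ℝ, a ^ 2 = 1 → ∀ i < r,
      |(derivative^[i] (derivative^[k + r] u)).eval a *
        (derivative^[k' + r - 1 - i] v).eval a| ≤
        F * (M ^ 2 * ((k : ℝ) ^ (2 * r) * (k' : ℝ) ^ (2 * r - 2))) := by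
    intro a ha i hi
    rw [← Function.iterate_add_apply, show i + (k + r) = k + (r + i) by omega,
      show k' + r - 1 - i = k' + (r - 1 - i) by omega, abs_mul]
    have h1 := abs_eval_iterate_derivative_le ha hk (r + i)
    have h2 := abs_eval_iterate_derivative_le ha hk' (r - 1 - i)
    have hc : ∀ m : ℕ, m ≤ 2 * r → (1 + (m : ℝ)) ^ m ≤ M := by
      intro m hm
      have hm' : (m : ℝ) ≤ 2 * r := by exact_mod_cast hm
      calc (1 + (m : ℝ)) ^ m ≤ (1 + 2 * r) ^ m := by gcongr
        _ ≤ M := pow_le_pow_right₀ (by linarith) hm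
    have hpow : (k : ℝ) ^ (2 * (r + i)) * (k' : ℝ) ^ (2 * (r - 1 - i)) ≤
        (k : ℝ) ^ (2 * r) * (k' : ℝ) ^ (2 * r - 2) := by
      rw [show 2 * (r + i) = 2 * r + 2 * i by ring, pow_add,
        show 2 * r - 2 = 2 * i + 2 * (r - 1 - i) by omega, pow_add, mul_assoc]
      gcongr
    calc _ ≤ ((2 ^ k * k.factorial) * ((1 + (r + i : ℕ)) ^ (r + i) * (k : ℝ) ^ (2 * (r + i)))) *
          ((2 ^ k' * k'.factorial) *
            ((1 + (r - 1 - i : ℕ)) ^ (r - 1 - i) * (k' : ℝ) ^ (2 * (r - 1 - i)))) := by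
            gcongr
      _ ≤ ((2 ^ k * k.factorial) * (M * (k : ℝ) ^ (2 * (r + i)))) *
          ((2 ^ k' * k'.factorial) * (M * (k' : ℝ) ^ (2 * (r - 1 - i)))) := by
            gcongr
            · exact hc _ (by omega)
            · exact hc _ (by omega)
      _ = F * (M ^ 2 * ((k : ℝ) ^ (2 * (r + i)) * (k' : ℝ) ^ (2 * (r - 1 - i)))) := by
            rw [hF]; ring
      _ ≤ _ := by gcongr
  set W : ℝ := (k : ℝ) ^ (2 * r) * (k' : ℝ) ^ (2 * r - 2) with hW
  have hsum : |∑ i ∈ Finset.range (k' + r), (-1 : ℝ) ^ i *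
        ((derivative^[i] (derivative^[k + r] u)).eval 1 * (derivative^[k' + r - 1 - i] v).eval 1 -
          (derivative^[i] (derivative^[k + r] u)).eval (-1) *
            (derivative^[k' + r - 1 - i] v).eval (-1))| ≤ r * (2 * (F * (M ^ 2 * W))) := by
    rw [Nat.add_comm k' r, Finset.sum_range_add]
    rw [Finset.sum_eq_zero (s := Finset.range k'), add_zero]
    · refine (Finset.abs_sum_le_sum_abs _ _).trans ?_
      refine (Finset.sum_le_card_nsmul _ _ (2 * (F * (M ^ 2 * W))) fun i hi => ?_).trans
        (by simp)
      have hi' := Finset.mem_range.1 hi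
      rw [abs_mul, abs_pow, abs_neg, abs_one, one_pow, one_mul, Nat.add_comm r k', two_mul]
      exact (abs_sub _ _).trans (add_le_add (hbd 1 (by norm_num) i hi')
        (hbd (-1) (by norm_num) i hi'))
    · intro i hi
      have hi' := Finset.mem_range.1 hi
      rw [hv, eval_iterate_derivative_sq_sub_one_pow_of_lt (by norm_num) (by omega),
        eval_iterate_derivative_sq_sub_one_pow_of_lt (by norm_num) (by omega)]
      simp
  have hN : ∀ l : ℕ, 1 ≤ l → |rodriguesFactor l| * (2 ^ l * l.factorial) ≤
      Real.sqrt 2 * Real.sqrt l := by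
    intro l hl
    have hl' : (1 : ℝ) ≤ l := by exact_mod_cast hl
    rw [rodriguesFactor, abs_of_nonneg (by positivity), mul_assoc, inv_mul_cancel₀ (by positivity),
      mul_one, ← Real.sqrt_mul zero_le_two]
    exact Real.sqrt_le_sqrt (by linarith)
  rw [hG, abs_mul, abs_mul]
  have h2 : Real.sqrt 2 * Real.sqrt 2 = 2 := Real.mul_self_sqrt zero_le_two
  calc _ ≤ |rodriguesFactor k| * |rodriguesFactor k'| * (r * (2 * (F * (M ^ 2 * W)))) := by
        gcongr
    _ = (|rodriguesFactor k| * (2 ^ k * k.factorial)) *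
          (|rodriguesFactor k'| * (2 ^ k' * k'.factorial)) * (r * (2 * (M ^ 2 * W))) := by
        rw [hF]; ring
    _ ≤ (Real.sqrt 2 * Real.sqrt k) * (Real.sqrt 2 * Real.sqrt k') *
          (r * (2 * (M ^ 2 * W))) := by
        exact mul_le_mul_of_nonneg_right
          (mul_le_mul (hN k hk) (hN k' hk') (by positivity) (by positivity)) (by positivity)
    _ = (Real.sqrt 2 * Real.sqrt 2) * (r * (2 * M ^ 2)) * (Real.sqrt k * Real.sqrt k') * W := by
        ring
    _ = _ := by rw [h2]

/-- Almost orthogonality: between dyadic frequency blocks `[2^a, 2^(a+1))` the normalised Gram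
matrix of the derivatives decays geometrically in the distance of the blocks. -/
theorem abs_gram_le {r : ℕ} (hr : 1 ≤ r) :
    ∃ C : ℝ, 0 < C ∧ ∀ k k' : ℕ, 1 ≤ k → 1 ≤ k' →
      |gram r k k'| ≤ C * ((k : ℝ) ^ (2 * r - 1 / 2 : ℝ) * (k' : ℝ) ^ (2 * r - 1 / 2 : ℝ)) *
        (1 / 2) ^ Nat.dist (Nat.log 2 k) (Nat.log 2 k') := by
  obtain ⟨C, hC, h⟩ := abs_gram_le_of_le hr
  have key : ∀ k k' : ℕ, 1 ≤ k → k ≤ k' →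
      |gram r k k'| ≤ 2 * C * ((k : ℝ) ^ (2 * r - 1 / 2 : ℝ) * (k' : ℝ) ^ (2 * r - 1 / 2 : ℝ)) *
        (1 / 2) ^ Nat.dist (Nat.log 2 k) (Nat.log 2 k') := by
    intro k k' hk hkk'
    have hk0 : (0 : ℝ) < k := by exact_mod_cast hk
    have hk0' : (0 : ℝ) < k' := by exact_mod_cast hk.trans hkk'
    refine (h k k' hk hkk').trans ?_
    set a := Nat.log 2 k
    set b := Nat.log 2 k'
    have hab : a ≤ b := Nat.log_mono_right hkk'
    have hratio : (k : ℝ) ≤ k' * (2 * (1 / 2) ^ (b - a)) := by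
      have h1 : (k : ℝ) ≤ 2 ^ (a + 1) := by
        exact_mod_cast (Nat.lt_pow_succ_log_self one_lt_two k).le
      have h2 : (2 : ℝ) ^ b ≤ k' := by
        exact_mod_cast Nat.pow_log_le_self 2 (by omega)
      calc (k : ℝ) ≤ 2 ^ (a + 1) := h1
        _ = 2 ^ b * (2 * (1 / 2) ^ (b - a)) := by
          rw [show b = a + (b - a) by omega, Nat.add_sub_cancel_left, pow_add, pow_succ]
          rw [one_div, inv_pow]
          field_simp
          rw [pow_add]
        _ ≤ _ := by gcongr
    have e1 : Real.sqrt k * (k : ℝ) ^ (2 * r) = (k : ℝ) ^ (2 * r - 1 / 2 : ℝ) * k := by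
      rw [Real.sqrt_eq_rpow, ← Real.rpow_natCast, ← Real.rpow_add hk0,
        ← Real.rpow_add_one hk0.ne']
      congr 1; push_cast; ring
    have e2 : Real.sqrt k' * (k' : ℝ) ^ (2 * r - 2) * k' = (k' : ℝ) ^ (2 * r - 1 / 2 : ℝ) := by
      rw [Real.sqrt_eq_rpow, ← Real.rpow_natCast, ← Real.rpow_add hk0',
        ← Real.rpow_add_one hk0'.ne']
      congr 1; push_cast [show 2 ≤ 2 * r by omega]; ring
    rw [show Nat.dist a b = b - a from Nat.dist_eq_sub_of_le hab]
    calc C * (Real.sqrt k * Real.sqrt k') * ((k : ℝ) ^ (2 * r) * (k' : ℝ) ^ (2 * r - 2))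
        = C * (Real.sqrt k * (k : ℝ) ^ (2 * r)) * (Real.sqrt k' * (k' : ℝ) ^ (2 * r - 2)) := by
          ring
      _ = C * ((k : ℝ) ^ (2 * r - 1 / 2 : ℝ) * k) * (Real.sqrt k' * (k' : ℝ) ^ (2 * r - 2)) := by
          rw [e1]
      _ ≤ C * ((k : ℝ) ^ (2 * r - 1 / 2 : ℝ) * (k' * (2 * (1 / 2) ^ (b - a)))) *
            (Real.sqrt k' * (k' : ℝ) ^ (2 * r - 2)) := by gcongr
      _ = 2 * C * ((k : ℝ) ^ (2 * r - 1 / 2 : ℝ) *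
            (Real.sqrt k' * (k' : ℝ) ^ (2 * r - 2) * k')) * (1 / 2) ^ (b - a) := by ring
      _ = _ := by rw [e2]
  refine ⟨2 * C, by positivity, fun k k' hk hk' => ?_⟩
  rcases le_total k k' with hle | hle
  · exact key k k' hk hle
  · rw [gram_comm, mul_comm ((k : ℝ) ^ _), Nat.dist_comm]
    exact key k' k hk' hle

theorem derivProd_eq_zero {r₁ r₂ k j : ℕ} (h : k < r₁ ∨ j < r₂) : derivProd r₁ r₂ k j = 0 := by
  have h0 : derivProdFun r₁ r₂ k j = 0 := by
    ext z
    rcases h with h | h <;> simp [derivProdFun, derivative_legendre_eq_zero h]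
  unfold derivProd
  rw [← MemLp.toLp_zero (MemLp.zero (p := 2) (μ := volQ) (ε := ℝ))]
  congr 1

theorem inner_derivProd (r₁ r₂ k j k' j' : ℕ) :
    inner ℝ (derivProd r₁ r₂ k j) (derivProd r₁ r₂ k' j') = gram r₁ k k' * gram r₂ j j' := by
  rw [L2.inner_def]
  have h : ∀ᵐ z ∂volQ, inner ℝ (derivProd r₁ r₂ k j z) (derivProd r₁ r₂ k' j' z) =
      ((derivative^[r₁] (legendre k)).eval z.1 * (derivative^[r₁] (legendre k')).eval z.1) *
      ((derivative^[r₂] (legendre j)).eval z.2 * (derivative^[r₂] (legendre j')).eval z.2) := by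
    filter_upwards [(memLp_derivProdFun r₁ r₂ k j).coeFn_toLp,
      (memLp_derivProdFun r₁ r₂ k' j').coeFn_toLp] with z h1 h2
    rw [derivProd, derivProd, h1, h2]
    simp only [derivProdFun, RCLike.inner_apply, conj_trivial]
    ring
  rw [integral_congr_ae h, volQ, Q, Measure.volume_eq_prod, ← Measure.prod_restrict,
    integral_prod_mul (fun x => (derivative^[r₁] (legendre k)).eval x *
      (derivative^[r₁] (legendre k')).eval x) (fun x => (derivative^[r₂] (legendre j)).eval x *
      (derivative^[r₂] (legendre j')).eval x)]
  simp only [gram, intervalIntegral.integral_of_le (show (-1 : ℝ) ≤ 1 by norm_num),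
    integral_Icc_eq_integral_Ioc]

end

/-! ### Sums over dyadic blocks -/

theorem sum_half_pow_dist_le (S : Finset ℕ) (a : ℕ) :
    ∑ b ∈ S, (1 / 2 : ℝ) ^ Nat.dist a b ≤ 4 := by
  obtain ⟨N, hN⟩ := S.exists_nat_subset_range
  have hsub : S ⊆ Finset.range (a + 1 + N) :=
    hN.trans (Finset.range_subset_range.2 (by omega))
  have hgeo : ∀ M : ℕ, ∑ i ∈ Finset.range M, (1 / 2 : ℝ) ^ i ≤ 2 := fun M => by
    have := sum_geometric_two_le M
    simpa using this
  calc ∑ b ∈ S, (1 / 2 : ℝ) ^ Nat.dist a b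
      ≤ ∑ b ∈ Finset.range (a + 1 + N), (1 / 2 : ℝ) ^ Nat.dist a b :=
        Finset.sum_le_sum_of_subset_of_nonneg hsub fun _ _ _ => by positivity
    _ = ∑ b ∈ Finset.range (a + 1), (1 / 2 : ℝ) ^ Nat.dist a b +
          ∑ i ∈ Finset.range N, (1 / 2 : ℝ) ^ Nat.dist a (a + 1 + i) :=
        Finset.sum_range_add _ _ _
    _ ≤ ∑ b ∈ Finset.range (a + 1), (1 / 2 : ℝ) ^ b + ∑ i ∈ Finset.range N, (1 / 2 : ℝ) ^ i := by
        gcongr ?_ + ?_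
        · rw [← Finset.sum_range_reflect (fun b => (1 / 2 : ℝ) ^ b)]
          refine Finset.sum_le_sum fun b hb => ?_
          have := Finset.mem_range.1 hb
          rw [Nat.dist_comm, Nat.dist_eq_sub_of_le (by omega)]
          simp
        · refine Finset.sum_le_sum fun i _ => ?_
          rw [Nat.dist_eq_sub_of_le (by omega)]
          exact pow_le_pow_of_le_one (by norm_num) (by norm_num) (by omega)
    _ ≤ 2 + 2 := add_le_add (hgeo _) (hgeo _)
    _ = 4 := by norm_num

/-- Schur's test for vectors whose Gram matrix is dominated blockwise by a symmetric kernel `K`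
with bounded row sums: the blocks are almost orthogonal, and the triangle inequality is
used only within each block. -/
theorem norm_sum_smul_sq_le {ι κ V : Type*} [DecidableEq κ] [NormedAddCommGroup V]
    [InnerProductSpace ℝ V] (blk : ι → κ) (v : ι → V) (w : ι → ℝ) (K : κ → κ → ℝ) {C R : ℝ}
    (hC : 0 ≤ C) (hK : ∀ u u', 0 ≤ K u u') (hsymm : ∀ u u', K u u' = K u' u)
    (hR : ∀ (S : Finset κ) (u : κ), ∑ u' ∈ S, K u u' ≤ R) (F : Finset ι)
    (hv : ∀ x ∈ F, ∀ y ∈ F, |inner ℝ (v x) (v y)| ≤ C * (w x * w y) * K (blk x) (blk y))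
    (a : ι → ℝ) :
    ‖∑ x ∈ F, a x • v x‖ ^ 2 ≤
      C * R * ∑ u ∈ F.image blk, (∑ x ∈ F with blk x = u, |a x| * w x) ^ 2 := by
  set b : ι → ℝ := fun x => |a x| * w x with hb
  set S := F.image blk
  set B : κ → ℝ := fun u => ∑ x ∈ F with blk x = u, b x with hB
  have hmaps : ∀ x ∈ F, blk x ∈ S := fun x hx => Finset.mem_image_of_mem _ hx
  have h1 : ‖∑ x ∈ F, a x • v x‖ ^ 2 ≤
      ∑ x ∈ F, ∑ y ∈ F, C * (b x * b y * K (blk x) (blk y)) := by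
    rw [← real_inner_self_eq_norm_sq, sum_inner]
    refine Finset.sum_le_sum fun x hx => ?_
    rw [inner_sum]
    refine Finset.sum_le_sum fun y hy => ?_
    rw [real_inner_smul_left, real_inner_smul_right]
    refine (le_abs_self _).trans ?_
    rw [abs_mul, abs_mul]
    calc |a x| * (|a y| * |inner ℝ (v x) (v y)|)
        ≤ |a x| * (|a y| * (C * (w x * w y) * K (blk x) (blk y))) := by
          gcongr
          exact hv x hx y hy
      _ = _ := by simp only [hb]; ring
  have h2 : ∑ x ∈ F, ∑ y ∈ F, C * (b x * b y * K (blk x) (blk y)) =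
      C * ∑ u ∈ S, ∑ u' ∈ S, B u * B u' * K u u' := by
    rw [Finset.mul_sum, ← Finset.sum_fiberwise_of_maps_to hmaps]
    refine Finset.sum_congr rfl fun u _ => ?_
    simp_rw [← Finset.sum_fiberwise_of_maps_to hmaps
      (fun y => C * (b _ * b y * K (blk _) (blk y)))]
    rw [Finset.sum_comm, Finset.mul_sum]
    refine Finset.sum_congr rfl fun u' _ => ?_
    simp only [hB]
    rw [Finset.sum_mul_sum, Finset.sum_mul, Finset.mul_sum]
    refine Finset.sum_congr rfl fun x hx => ?_
    rw [Finset.sum_mul, Finset.mul_sum]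
    refine Finset.sum_congr rfl fun y hy => ?_
    rw [(Finset.mem_filter.1 hx).2, (Finset.mem_filter.1 hy).2]
  have h3 : ∑ u ∈ S, ∑ u' ∈ S, B u * B u' * K u u' ≤ R * ∑ u ∈ S, B u ^ 2 := by
    have e1 : ∑ u ∈ S, ∑ u' ∈ S, B u * B u' * K u u' ≤
        ∑ u ∈ S, ∑ u' ∈ S, (B u ^ 2 * K u u' / 2 + B u' ^ 2 * K u' u / 2) := by
      refine Finset.sum_le_sum fun u _ => Finset.sum_le_sum fun u' _ => ?_
      rw [hsymm u' u]
      nlinarith [mul_nonneg (sq_nonneg (B u - B u')) (hK u u')]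
    refine e1.trans ?_
    simp only [Finset.sum_add_distrib]
    rw [Finset.sum_comm (f := fun u u' => B u' ^ 2 * K u' u / 2), ← Finset.sum_add_distrib,
      Finset.mul_sum]
    refine Finset.sum_le_sum fun u _ => ?_
    rw [← Finset.sum_add_distrib]
    calc ∑ u' ∈ S, (B u ^ 2 * K u u' / 2 + B u ^ 2 * K u u' / 2)
        = B u ^ 2 * ∑ u' ∈ S, K u u' := by
          rw [Finset.mul_sum]; exact Finset.sum_congr rfl fun _ _ => by ring
      _ ≤ B u ^ 2 * R := by gcongr; exact hR S u
      _ = R * B u ^ 2 := mul_comm _ _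
  calc _ ≤ _ := h1
    _ = _ := h2
    _ ≤ C * (R * ∑ u ∈ S, B u ^ 2) := by gcongr
    _ = _ := by ring

/-- The dyadic block `(a, b)` of a pair `(k, j)`: `2^a ≤ k < 2^(a+1)` and `2^b ≤ j < 2^(b+1)`.
Only used for `k, j ≥ 1`; `Nat.log` would put `0` into the block of `1`. -/
def dyadicBlock (x : ℕ × ℕ) : ℕ × ℕ := (Nat.log 2 x.1, Nat.log 2 x.2)

theorem two_pow_le_and_lt {k a : ℕ} (hk : 1 ≤ k) (h : Nat.log 2 k = a) :
    2 ^ a ≤ k ∧ k < 2 ^ (a + 1) := by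
  subst h
  exact ⟨Nat.pow_log_le_self 2 (by omega), Nat.lt_pow_succ_log_self one_lt_two k⟩

/-- A power of `k` is comparable to the same power of `2^a` on a dyadic block. -/
theorem rpow_le_of_log_eq {k a : ℕ} (hk : 1 ≤ k) (h : Nat.log 2 k = a) (t : ℝ) :
    (k : ℝ) ^ t ≤ 2 ^ |t| * (2 ^ (a : ℝ)) ^ t := by
  obtain ⟨h1, h2⟩ := two_pow_le_and_lt hk h
  have h1' : (2 : ℝ) ^ (a : ℝ) ≤ k := by rw [Real.rpow_natCast]; exact_mod_cast h1
  have h2' : (k : ℝ) ≤ 2 * 2 ^ (a : ℝ) := by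
    rw [Real.rpow_natCast, mul_comm, ← pow_succ]; exact_mod_cast h2.le
  have h0 : (0 : ℝ) < 2 ^ (a : ℝ) := by positivity
  rcases le_total 0 t with ht | ht
  · rw [abs_of_nonneg ht, ← Real.mul_rpow zero_le_two h0.le]
    exact Real.rpow_le_rpow (Nat.cast_nonneg _) h2' ht
  · calc (k : ℝ) ^ t ≤ (2 ^ (a : ℝ)) ^ t := Real.rpow_le_rpow_of_nonpos h0 h1' ht
      _ ≤ _ := le_mul_of_one_le_left (by positivity)
        (Real.one_le_rpow one_le_two (abs_nonneg t))

theorem card_filter_dyadicBlock_le (F : Finset (ℕ × ℕ)) (hF : ∀ x ∈ F, 1 ≤ x.1 ∧ 1 ≤ x.2)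
    (u : ℕ × ℕ) : (F.filter fun x => dyadicBlock x = u).card ≤ 2 ^ u.1 * 2 ^ u.2 := by
  have hsub : (F.filter fun x => dyadicBlock x = u) ⊆
      Finset.Ico (2 ^ u.1) (2 ^ (u.1 + 1)) ×ˢ Finset.Ico (2 ^ u.2) (2 ^ (u.2 + 1)) := by
    intro x hx
    obtain ⟨hxF, hxu⟩ := Finset.mem_filter.1 hx
    obtain ⟨h1, h2⟩ := hF x hxF
    have e1 : Nat.log 2 x.1 = u.1 := (Prod.ext_iff.1 hxu).1
    have e2 : Nat.log 2 x.2 = u.2 := (Prod.ext_iff.1 hxu).2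
    exact Finset.mem_product.2 ⟨Finset.mem_Ico.2 (two_pow_le_and_lt h1 e1),
      Finset.mem_Ico.2 (two_pow_le_and_lt h2 e2)⟩
  refine (Finset.card_le_card hsub).trans (le_of_eq ?_)
  rw [Finset.card_product, Nat.card_Ico, Nat.card_Ico, pow_succ, pow_succ]
  congr 1 <;> omega

/-- The block estimate. The hypothesis on `h` is the form in which an `ℓ_p` bound, `q = 1 / p`,
enters; the weight `(k j)^(-m)` covers smooth coefficients (`m = μ`) and noise (`m = 0`). -/
theorem norm_sum_derivProd_sq_le {r₁ r₂ : ℕ} (h₁ : 1 ≤ r₁) (h₂ : 1 ≤ r₂) (m q : ℝ) (hq : q ≤ 1) :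
    ∃ C : ℝ, 0 < C ∧ ∀ (D : ℝ), 0 ≤ D → ∀ (h a : ℕ × ℕ → ℝ),
      (∀ S : Finset (ℕ × ℕ), ∑ x ∈ S, |h x| ≤ D * (S.card : ℝ) ^ (1 - q)) →
      ∀ F : Finset (ℕ × ℕ), (∀ x ∈ F, 1 ≤ x.1 ∧ 1 ≤ x.2) →
      (∀ x ∈ F, |a x| = |h x| * ((x.1 : ℝ) ^ (-m) * (x.2 : ℝ) ^ (-m))) →
      ‖∑ x ∈ F, a x • derivProd r₁ r₂ x.1 x.2‖ ^ 2 ≤ C * D ^ 2 *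
        ∑ u ∈ F.image dyadicBlock,
          (2 ^ (u.1 : ℝ)) ^ (2 * (2 * r₁ + 1 / 2 - m - q)) *
          (2 ^ (u.2 : ℝ)) ^ (2 * (2 * r₂ + 1 / 2 - m - q)) := by
  obtain ⟨C₁, hC₁, hG₁⟩ := abs_gram_le h₁
  obtain ⟨C₂, hC₂, hG₂⟩ := abs_gram_le h₂
  set σ₁ : ℝ := 2 * r₁ - 1 / 2 with hσ₁
  set σ₂ : ℝ := 2 * r₂ - 1 / 2 with hσ₂
  set c : ℝ := 2 ^ |σ₁ - m| * 2 ^ |σ₂ - m| with hc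
  have hc0 : 0 < c := by positivity
  refine ⟨C₁ * C₂ * 16 * c ^ 2, by positivity, fun D hD h a hh F hF ha => ?_⟩
  have hS := norm_sum_smul_sq_le dyadicBlock (fun x : ℕ × ℕ => derivProd r₁ r₂ x.1 x.2)
    (fun x => (x.1 : ℝ) ^ σ₁ * (x.2 : ℝ) ^ σ₂)
    (fun u u' => (1 / 2 : ℝ) ^ Nat.dist u.1 u'.1 * (1 / 2 : ℝ) ^ Nat.dist u.2 u'.2)
    (C := C₁ * C₂) (R := 16) (by positivity) (fun _ _ => by positivity)
    (fun u u' => by rw [Nat.dist_comm u.1, Nat.dist_comm u.2])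
    (fun S u => by
      have hsub : S ⊆ S.image Prod.fst ×ˢ S.image Prod.snd := Finset.subset_product
      calc ∑ u' ∈ S, (1 / 2 : ℝ) ^ Nat.dist u.1 u'.1 * (1 / 2 : ℝ) ^ Nat.dist u.2 u'.2
          ≤ ∑ u' ∈ S.image Prod.fst ×ˢ S.image Prod.snd,
              (1 / 2 : ℝ) ^ Nat.dist u.1 u'.1 * (1 / 2 : ℝ) ^ Nat.dist u.2 u'.2 :=
            Finset.sum_le_sum_of_subset_of_nonneg hsub fun _ _ _ => by positivity
        _ = (∑ i ∈ S.image Prod.fst, (1 / 2 : ℝ) ^ Nat.dist u.1 i) *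
              ∑ i ∈ S.image Prod.snd, (1 / 2 : ℝ) ^ Nat.dist u.2 i := by
            rw [Finset.sum_mul_sum, Finset.sum_product]
        _ ≤ 4 * 4 := by
            gcongr
            · exact sum_half_pow_dist_le _ _
            · exact sum_half_pow_dist_le _ _
        _ = 16 := by norm_num) F
    (fun x hx y hy => by
      rw [inner_derivProd, abs_mul]
      have g1 := hG₁ x.1 y.1 (hF x hx).1 (hF y hy).1
      have g2 := hG₂ x.2 y.2 (hF x hx).2 (hF y hy).2
      refine (mul_le_mul g1 g2 (abs_nonneg _) (by positivity)).trans (le_of_eq ?_)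
      simp only [dyadicBlock, hσ₁, hσ₂]
      ring) a
  refine hS.trans ?_
  have hblock : ∀ u : ℕ × ℕ,
      ∑ x ∈ F with dyadicBlock x = u, |a x| * ((x.1 : ℝ) ^ σ₁ * (x.2 : ℝ) ^ σ₂) ≤
        c * D * ((2 ^ (u.1 : ℝ)) ^ (2 * r₁ + 1 / 2 - m - q) *
          (2 ^ (u.2 : ℝ)) ^ (2 * r₂ + 1 / 2 - m - q)) := by
    intro u
    have hA : (0 : ℝ) < 2 ^ (u.1 : ℝ) := by positivity
    have hB : (0 : ℝ) < 2 ^ (u.2 : ℝ) := by positivity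
    calc ∑ x ∈ F with dyadicBlock x = u, |a x| * ((x.1 : ℝ) ^ σ₁ * (x.2 : ℝ) ^ σ₂)
        ≤ ∑ x ∈ F with dyadicBlock x = u,
            (c * ((2 ^ (u.1 : ℝ)) ^ (σ₁ - m) * (2 ^ (u.2 : ℝ)) ^ (σ₂ - m))) * |h x| := by
          refine Finset.sum_le_sum fun x hx => ?_
          obtain ⟨hxF, hxu⟩ := Finset.mem_filter.1 hx
          obtain ⟨hx1, hx2⟩ := hF x hxF
          have hp1 : (0 : ℝ) < x.1 := by exact_mod_cast hx1
          have hp2 : (0 : ℝ) < x.2 := by exact_mod_cast hx2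
          rw [ha x hxF]
          have e1 := rpow_le_of_log_eq hx1 (Prod.ext_iff.1 hxu).1 (σ₁ - m)
          have e2 := rpow_le_of_log_eq hx2 (Prod.ext_iff.1 hxu).2 (σ₂ - m)
          calc |h x| * ((x.1 : ℝ) ^ (-m) * (x.2 : ℝ) ^ (-m)) * ((x.1 : ℝ) ^ σ₁ * (x.2 : ℝ) ^ σ₂)
              = |h x| * ((x.1 : ℝ) ^ (σ₁ - m) * (x.2 : ℝ) ^ (σ₂ - m)) := by
                rw [sub_eq_add_neg, sub_eq_add_neg, Real.rpow_add hp1, Real.rpow_add hp2]; ring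
            _ ≤ |h x| * ((2 ^ |σ₁ - m| * (2 ^ (u.1 : ℝ)) ^ (σ₁ - m)) *
                  (2 ^ |σ₂ - m| * (2 ^ (u.2 : ℝ)) ^ (σ₂ - m))) := by gcongr
            _ = _ := by rw [hc]; ring
      _ ≤ (c * ((2 ^ (u.1 : ℝ)) ^ (σ₁ - m) * (2 ^ (u.2 : ℝ)) ^ (σ₂ - m))) *
            (D * (2 ^ (u.1 : ℝ) * 2 ^ (u.2 : ℝ)) ^ (1 - q)) := by
          rw [← Finset.mul_sum]
          gcongr
          refine (hh _).trans ?_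
          gcongr
          rw [Real.rpow_natCast, Real.rpow_natCast]
          exact_mod_cast card_filter_dyadicBlock_le F hF u
      _ = _ := by
          rw [Real.mul_rpow hA.le hB.le,
            show 2 * (r₁ : ℝ) + 1 / 2 - m - q = (σ₁ - m) + (1 - q) by rw [hσ₁]; ring,
            show 2 * (r₂ : ℝ) + 1 / 2 - m - q = (σ₂ - m) + (1 - q) by rw [hσ₂]; ring,
            Real.rpow_add hA, Real.rpow_add hB]
          ring
  calc C₁ * C₂ * 16 * ∑ u ∈ F.image dyadicBlock,
        (∑ x ∈ F with dyadicBlock x = u, |a x| * ((x.1 : ℝ) ^ σ₁ * (x.2 : ℝ) ^ σ₂)) ^ 2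
      ≤ C₁ * C₂ * 16 * ∑ u ∈ F.image dyadicBlock,
        (c * D * ((2 ^ (u.1 : ℝ)) ^ (2 * r₁ + 1 / 2 - m - q) *
          (2 ^ (u.2 : ℝ)) ^ (2 * r₂ + 1 / 2 - m - q))) ^ 2 := by
        gcongr with u hu
        exact hblock u
    _ = _ := by
        rw [Finset.mul_sum, Finset.mul_sum]
        refine Finset.sum_congr rfl fun u _ => ?_
        rw [mul_comm 2 (2 * (r₁ : ℝ) + 1 / 2 - m - q), mul_comm 2 (2 * (r₂ : ℝ) + 1 / 2 - m - q),
          Real.rpow_mul (by positivity), Real.rpow_mul (by positivity), Real.rpow_two,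
          Real.rpow_two]
        ring

/-! ### Geometric sums over hyperbolic crosses -/

theorem sum_two_rpow_le {θ : ℝ} (hθ : 0 < θ) :
    ∃ C : ℝ, 0 < C ∧ ∀ (S : Finset ℕ) (M : ℝ), 0 < M → (∀ a ∈ S, (2 : ℝ) ^ (a : ℝ) ≤ M) →
      ∑ a ∈ S, ((2 : ℝ) ^ (a : ℝ)) ^ θ ≤ C * M ^ θ := by
  have hρ : (1 : ℝ) < 2 ^ θ := Real.one_lt_rpow one_lt_two hθ
  have hswap : ∀ a : ℕ, ((2 : ℝ) ^ (a : ℝ)) ^ θ = (2 ^ θ) ^ a := fun a => by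
    rw [← Real.rpow_mul zero_le_two, mul_comm, Real.rpow_mul zero_le_two, Real.rpow_natCast]
  refine ⟨2 ^ θ / (2 ^ θ - 1), div_pos (by positivity) (by linarith), fun S M hM hS => ?_⟩
  rcases S.eq_empty_or_nonempty with rfl | hne
  · have : 0 < (2 : ℝ) ^ θ - 1 := by linarith
    simp only [Finset.sum_empty]
    positivity
  set A := S.max' hne with hA
  have hsub : S ⊆ Finset.range (A + 1) := fun a ha =>
    Finset.mem_range.2 (Nat.lt_succ_of_le (S.le_max' a ha))
  have hAM : ((2 : ℝ) ^ θ) ^ A ≤ M ^ θ := by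
    rw [← hswap]
    exact Real.rpow_le_rpow (by positivity) (hS A (S.max'_mem hne)) hθ.le
  simp_rw [hswap]
  calc ∑ a ∈ S, ((2 : ℝ) ^ θ) ^ a ≤ ∑ a ∈ Finset.range (A + 1), ((2 : ℝ) ^ θ) ^ a :=
        Finset.sum_le_sum_of_subset_of_nonneg hsub fun _ _ _ => by positivity
    _ = ((2 ^ θ) ^ (A + 1) - 1) / (2 ^ θ - 1) := geom_sum_eq hρ.ne' _
    _ ≤ (2 ^ θ * M ^ θ) / (2 ^ θ - 1) := by
        have : 0 < (2 : ℝ) ^ θ - 1 := by linarith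
        gcongr
        rw [pow_succ]
        nlinarith
    _ = _ := by ring

theorem sum_two_rpow_neg_le {θ : ℝ} (hθ : 0 < θ) :
    ∃ C : ℝ, 0 < C ∧ ∀ (S : Finset ℕ) (M : ℝ), 0 < M → (∀ a ∈ S, M ≤ (2 : ℝ) ^ (a : ℝ)) →
      ∑ a ∈ S, ((2 : ℝ) ^ (a : ℝ)) ^ (-θ) ≤ C * M ^ (-θ) := by
  have hρ : (2 : ℝ) ^ (-θ) < 1 := Real.rpow_lt_one_of_one_lt_of_neg one_lt_two (by linarith)
  have hρ0 : (0 : ℝ) < 2 ^ (-θ) := by positivity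
  have hswap : ∀ a : ℕ, ((2 : ℝ) ^ (a : ℝ)) ^ (-θ) = (2 ^ (-θ)) ^ a := fun a => by
    rw [← Real.rpow_mul zero_le_two, mul_comm, Real.rpow_mul zero_le_two, Real.rpow_natCast]
  have h1 : 0 < 1 - (2 : ℝ) ^ (-θ) := by linarith
  refine ⟨(1 - 2 ^ (-θ))⁻¹, by positivity, fun S M hM hS => ?_⟩
  rcases S.eq_empty_or_nonempty with rfl | hne
  · simp only [Finset.sum_empty]
    positivity
  set A := S.min' hne with hA
  have hAM : ((2 : ℝ) ^ (-θ)) ^ A ≤ M ^ (-θ) := by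
    rw [← hswap]
    exact Real.rpow_le_rpow_of_nonpos hM (hS A (S.min'_mem hne)) (by linarith)
  simp_rw [hswap]
  have hinj : Set.InjOn (fun a => a - A) (S : Set ℕ) := fun a ha b hb hab => by
    have h1 := S.min'_le a ha
    have h2 := S.min'_le b hb
    simp only at hab
    omega
  calc ∑ a ∈ S, ((2 : ℝ) ^ (-θ)) ^ a
      = ((2 : ℝ) ^ (-θ)) ^ A * ∑ i ∈ S.image (fun a => a - A), ((2 : ℝ) ^ (-θ)) ^ i := by
        rw [Finset.sum_image hinj, Finset.mul_sum]
        refine Finset.sum_congr rfl fun a ha => ?_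
        rw [← pow_add, Nat.add_sub_cancel' (S.min'_le a ha)]
    _ ≤ M ^ (-θ) * (1 - 2 ^ (-θ))⁻¹ := by
        gcongr
        rw [← tsum_geometric_of_lt_one hρ0.le hρ]
        exact (summable_geometric_of_lt_one hρ0.le hρ).sum_le_tsum _ fun _ _ => by positivity
    _ = _ := mul_comm _ _

/-- Counting the `b` with `2^(γ b) ≤ N`. -/
theorem card_le_of_two_rpow_le {γ : ℝ} (hγ : 0 < γ) :
    ∃ C : ℝ, 0 < C ∧ ∀ (S : Finset ℕ) (N : ℝ), (∀ b ∈ S, ((2 : ℝ) ^ (b : ℝ)) ^ γ ≤ N) →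
      (S.card : ℝ) ≤ C * (1 + Real.posLog N) := by
  have hl2 : 0 < Real.log 2 := Real.log_pos one_lt_two
  refine ⟨1 + (γ * Real.log 2)⁻¹, by positivity, fun S N hS => ?_⟩
  have hpos : 0 ≤ Real.posLog N := Real.posLog_nonneg
  have hsub : S ⊆ Finset.range (⌊Real.posLog N / (γ * Real.log 2)⌋₊ + 1) := by
    intro b hb
    refine Finset.mem_range.2 (Nat.lt_succ_of_le (Nat.le_floor ?_))
    rw [le_div_iff₀ (by positivity)]
    have h := Real.log_le_log (by positivity) (hS b hb)
    rw [Real.log_rpow (by positivity), Real.log_rpow two_pos] at h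
    have h' : Real.log N ≤ Real.posLog N := le_max_right _ _
    linarith
  have hcard : (S.card : ℝ) ≤ ⌊Real.posLog N / (γ * Real.log 2)⌋₊ + 1 := by
    have := Finset.card_le_card hsub
    rw [Finset.card_range] at this
    exact_mod_cast this
  have hfl := Nat.floor_le (a := Real.posLog N / (γ * Real.log 2)) (by positivity)
  rw [div_eq_mul_inv] at hfl
  have hi : 0 < (γ * Real.log 2)⁻¹ := by positivity
  rw [div_eq_mul_inv] at hcard
  nlinarith

theorem sum_le_sum_sum_filter {f : ℕ × ℕ → ℝ} (hf : ∀ u, 0 ≤ f u) (P : ℕ × ℕ → Prop)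
    [DecidablePred P] (U : Finset (ℕ × ℕ)) (hU : ∀ u ∈ U, P u) :
    ∑ u ∈ U, f u ≤ ∑ b ∈ U.image Prod.snd, ∑ a ∈ (U.image Prod.fst).filter (fun a => P (a, b)),
      f (a, b) := by
  have hsub : U ⊆ (U.image Prod.fst ×ˢ U.image Prod.snd).filter P := fun u hu =>
    Finset.mem_filter.2 ⟨Finset.subset_product hu, hU u hu⟩
  refine (Finset.sum_le_sum_of_subset_of_nonneg hsub fun u _ _ => hf u).trans (le_of_eq ?_)
  rw [Finset.sum_filter, Finset.sum_product_right]
  exact Finset.sum_congr rfl fun b _ => (Finset.sum_filter _ _).symm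

/-- Summing a decaying product over the dyadic blocks outside a hyperbolic cross. -/
theorem sum_outside_cross_le {θ₁ θ₂ γ κ : ℝ} (h₁ : 0 < θ₁) (h₂ : 0 < θ₂) (hγ : 0 < γ)
    (hκ : (γ * θ₁ < θ₂ ∧ κ = 0) ∨ (γ * θ₁ = θ₂ ∧ κ = 1)) :
    ∃ C : ℝ, 0 < C ∧ ∀ N : ℝ, 0 < N → ∀ U : Finset (ℕ × ℕ),
      (∀ u ∈ U, N ≤ (2 : ℝ) ^ (u.1 : ℝ) * ((2 : ℝ) ^ (u.2 : ℝ)) ^ γ) →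
      ∑ u ∈ U, ((2 : ℝ) ^ (u.1 : ℝ)) ^ (-θ₁) * ((2 : ℝ) ^ (u.2 : ℝ)) ^ (-θ₂) ≤
        C * N ^ (-θ₁) * (1 + Real.posLog N) ^ κ := by
  classical
  obtain ⟨C₁, hC₁, H₁⟩ := sum_two_rpow_neg_le h₁
  have key : ∀ N : ℝ, 0 < N → ∀ U : Finset (ℕ × ℕ),
      (∀ u ∈ U, N ≤ (2 : ℝ) ^ (u.1 : ℝ) * ((2 : ℝ) ^ (u.2 : ℝ)) ^ γ) →
      ∑ u ∈ U, ((2 : ℝ) ^ (u.1 : ℝ)) ^ (-θ₁) * ((2 : ℝ) ^ (u.2 : ℝ)) ^ (-θ₂) ≤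
        C₁ * N ^ (-θ₁) * ∑ b ∈ U.image Prod.snd, ((2 : ℝ) ^ (b : ℝ)) ^ (γ * θ₁ - θ₂) := by
    intro N hN U hU
    refine (sum_le_sum_sum_filter (fun _ => by positivity) _ U hU).trans ?_
    rw [Finset.mul_sum]
    refine Finset.sum_le_sum fun b _ => ?_
    have hb : (0 : ℝ) < 2 ^ (b : ℝ) := by positivity
    dsimp only
    rw [← Finset.sum_mul]
    calc _ ≤ (C₁ * (N / ((2 : ℝ) ^ (b : ℝ)) ^ γ) ^ (-θ₁)) * ((2 : ℝ) ^ (b : ℝ)) ^ (-θ₂) := by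
          gcongr
          refine H₁ _ _ (by positivity) fun a ha => ?_
          rw [div_le_iff₀ (by positivity)]
          exact (Finset.mem_filter.1 ha).2
      _ = _ := by
          rw [Real.div_rpow hN.le (by positivity), ← Real.rpow_mul hb.le, sub_eq_add_neg,
            Real.rpow_add hb, mul_neg, Real.rpow_neg hb.le (γ * θ₁), div_inv_eq_mul]
          ring
  rcases hκ with ⟨hlt, rfl⟩ | ⟨heq, rfl⟩
  · obtain ⟨C₂, hC₂, H₂⟩ := sum_two_rpow_neg_le (sub_pos.2 hlt)
    refine ⟨C₁ * C₂, by positivity, fun N hN U hU => (key N hN U hU).trans ?_⟩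
    have h := H₂ (U.image Prod.snd) 1 one_pos fun b _ =>
      Real.one_le_rpow one_le_two (Nat.cast_nonneg b)
    rw [neg_sub, Real.one_rpow, mul_one] at h
    rw [Real.rpow_zero, mul_one]
    calc C₁ * N ^ (-θ₁) * ∑ b ∈ U.image Prod.snd, ((2 : ℝ) ^ (b : ℝ)) ^ (γ * θ₁ - θ₂)
        ≤ C₁ * N ^ (-θ₁) * C₂ := by gcongr
      _ = _ := by ring
  · -- In the critical case the blocks with `2^(γ b) ≤ N` contribute equally, whence the logarithm;
    -- beyond them `a` ranges freely and the sum over `b` converges.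
    obtain ⟨C₂, hC₂, H₂⟩ := sum_two_rpow_neg_le h₂
    obtain ⟨C₃, hC₃, H₃⟩ := card_le_of_two_rpow_le hγ
    refine ⟨C₁ * C₃ + C₁ * C₂, by positivity, fun N hN U hU => ?_⟩
    have hlog : 0 ≤ Real.posLog N := Real.posLog_nonneg
    rw [Real.rpow_one, ← Finset.sum_filter_add_sum_filter_not U
      (fun u => ((2 : ℝ) ^ (u.2 : ℝ)) ^ γ ≤ N)]
    have hlow : ∑ u ∈ U with ((2 : ℝ) ^ (u.2 : ℝ)) ^ γ ≤ N,
        ((2 : ℝ) ^ (u.1 : ℝ)) ^ (-θ₁) * ((2 : ℝ) ^ (u.2 : ℝ)) ^ (-θ₂) ≤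
        C₁ * C₃ * N ^ (-θ₁) * (1 + Real.posLog N) := by
      refine (key N hN _ fun u hu => hU u (Finset.mem_filter.1 hu).1).trans ?_
      simp only [heq, sub_self, Real.rpow_zero, Finset.sum_const, nsmul_eq_mul, mul_one]
      calc C₁ * N ^ (-θ₁) * _ ≤ C₁ * N ^ (-θ₁) * (C₃ * (1 + Real.posLog N)) := by
            gcongr
            refine H₃ _ _ fun b hb => ?_
            obtain ⟨u, hu, rfl⟩ := Finset.mem_image.1 hb
            exact (Finset.mem_filter.1 hu).2
        _ = _ := by ring
    have hhigh : ∑ u ∈ U with ¬ ((2 : ℝ) ^ (u.2 : ℝ)) ^ γ ≤ N,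
        ((2 : ℝ) ^ (u.1 : ℝ)) ^ (-θ₁) * ((2 : ℝ) ^ (u.2 : ℝ)) ^ (-θ₂) ≤
        C₁ * C₂ * N ^ (-θ₁) := by
      refine (sum_le_sum_sum_filter (fun _ => by positivity)
        (fun _ => True) _ fun _ _ => trivial).trans ?_
      calc _ ≤ ∑ b ∈ (U.filter fun u => ¬ ((2 : ℝ) ^ (u.2 : ℝ)) ^ γ ≤ N).image Prod.snd,
            C₁ * ((2 : ℝ) ^ (b : ℝ)) ^ (-θ₂) := by
            refine Finset.sum_le_sum fun b _ => ?_
            dsimp only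
            rw [← Finset.sum_mul]
            gcongr
            have h := fun S => H₁ S 1 one_pos fun a _ =>
              Real.one_le_rpow one_le_two (Nat.cast_nonneg a)
            simp only [Real.one_rpow, mul_one] at h
            exact h _
        _ ≤ C₁ * (C₂ * (N ^ (1 / γ)) ^ (-θ₂)) := by
            rw [← Finset.mul_sum]
            gcongr
            refine H₂ _ _ (by positivity) fun b hb => ?_
            obtain ⟨u, hu, rfl⟩ := Finset.mem_image.1 hb
            have hu' := (not_le.1 (Finset.mem_filter.1 hu).2).le
            have := Real.rpow_le_rpow hN.le hu' (by positivity : 0 ≤ 1 / γ)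
            rwa [← Real.rpow_mul (by positivity), mul_one_div_cancel hγ.ne', Real.rpow_one] at this
        _ = _ := by
            rw [← Real.rpow_mul hN.le, ← heq, mul_assoc]
            congr 3
            field_simp
    have : C₁ * C₂ * N ^ (-θ₁) ≤ C₁ * C₂ * N ^ (-θ₁) * (1 + Real.posLog N) :=
      le_mul_of_one_le_right (by positivity) (by linarith)
    calc _ ≤ C₁ * C₃ * N ^ (-θ₁) * (1 + Real.posLog N) +
          C₁ * C₂ * N ^ (-θ₁) * (1 + Real.posLog N) := add_le_add hlow (hhigh.trans this)
      _ = _ := by ring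

/-- Summing a growing product over the dyadic blocks inside a hyperbolic cross. -/
theorem sum_inside_cross_le {θ₁ θ₂ γ κ : ℝ} (h₁ : 0 < θ₁) (hγ : 0 < γ)
    (hκ : (θ₂ < γ * θ₁ ∧ κ = 0) ∨ (θ₂ = γ * θ₁ ∧ κ = 1)) :
    ∃ C : ℝ, 0 < C ∧ ∀ N : ℝ, 0 < N → ∀ U : Finset (ℕ × ℕ),
      (∀ u ∈ U, (2 : ℝ) ^ (u.1 : ℝ) * ((2 : ℝ) ^ (u.2 : ℝ)) ^ γ ≤ N) →
      ∑ u ∈ U, ((2 : ℝ) ^ (u.1 : ℝ)) ^ θ₁ * ((2 : ℝ) ^ (u.2 : ℝ)) ^ θ₂ ≤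
        C * N ^ θ₁ * (1 + Real.posLog N) ^ κ := by
  classical
  obtain ⟨C₁, hC₁, H₁⟩ := sum_two_rpow_le h₁
  have key : ∀ N : ℝ, 0 < N → ∀ U : Finset (ℕ × ℕ),
      (∀ u ∈ U, (2 : ℝ) ^ (u.1 : ℝ) * ((2 : ℝ) ^ (u.2 : ℝ)) ^ γ ≤ N) →
      ∑ u ∈ U, ((2 : ℝ) ^ (u.1 : ℝ)) ^ θ₁ * ((2 : ℝ) ^ (u.2 : ℝ)) ^ θ₂ ≤
        C₁ * N ^ θ₁ * ∑ b ∈ U.image Prod.snd, ((2 : ℝ) ^ (b : ℝ)) ^ (-(γ * θ₁ - θ₂)) := by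
    intro N hN U hU
    refine (sum_le_sum_sum_filter (fun _ => by positivity) _ U hU).trans ?_
    rw [Finset.mul_sum]
    refine Finset.sum_le_sum fun b _ => ?_
    have hb : (0 : ℝ) < 2 ^ (b : ℝ) := by positivity
    dsimp only
    rw [← Finset.sum_mul]
    calc _ ≤ (C₁ * (N / ((2 : ℝ) ^ (b : ℝ)) ^ γ) ^ θ₁) * ((2 : ℝ) ^ (b : ℝ)) ^ θ₂ := by
          gcongr
          refine H₁ _ _ (by positivity) fun a ha => ?_
          rw [le_div_iff₀ (by positivity)]
          exact (Finset.mem_filter.1 ha).2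
      _ = _ := by
          rw [Real.div_rpow hN.le (by positivity), ← Real.rpow_mul hb.le, neg_sub,
            sub_eq_add_neg, Real.rpow_add hb, Real.rpow_neg hb.le (γ * θ₁)]
          ring
  rcases hκ with ⟨hlt, rfl⟩ | ⟨heq, rfl⟩
  · obtain ⟨C₂, hC₂, H₂⟩ := sum_two_rpow_neg_le (sub_pos.2 hlt)
    refine ⟨C₁ * C₂, by positivity, fun N hN U hU => (key N hN U hU).trans ?_⟩
    have h := H₂ (U.image Prod.snd) 1 one_pos fun b _ =>
      Real.one_le_rpow one_le_two (Nat.cast_nonneg b)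
    rw [Real.one_rpow, mul_one] at h
    rw [Real.rpow_zero, mul_one, mul_right_comm C₁ C₂]
    gcongr
  · obtain ⟨C₃, hC₃, H₃⟩ := card_le_of_two_rpow_le hγ
    refine ⟨C₁ * C₃, by positivity, fun N hN U hU => (key N hN U hU).trans ?_⟩
    have h := H₃ (U.image Prod.snd) N fun b hb => by
      obtain ⟨u, hu, rfl⟩ := Finset.mem_image.1 hb
      exact (le_mul_of_one_le_left (by positivity)
        (Real.one_le_rpow one_le_two (Nat.cast_nonneg u.1))).trans (hU u hu)
    simp only [heq, sub_self, neg_zero, Real.rpow_zero, Finset.sum_const, nsmul_eq_mul, mul_one,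
      Real.rpow_one]
    calc C₁ * N ^ θ₁ * ((U.image Prod.snd).card : ℝ)
        ≤ C₁ * N ^ θ₁ * (C₃ * (1 + Real.posLog N)) := by gcongr
      _ = _ := by ring

/-! ### Truncation error and propagated noise -/

/-- Hölder's inequality on finite sets, with `q = 1 / s`. -/
theorem sum_abs_le_mul_card_rpow {ι : Type*} {s D : ℝ} (hs : 1 ≤ s) (hD : 0 ≤ D) (S : Finset ι)
    (h : ι → ℝ) (hS : ∑ x ∈ S, |h x| ^ s ≤ D ^ s) :
    ∑ x ∈ S, |h x| ≤ D * (S.card : ℝ) ^ (1 - 1 / s) := by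
  have hs0 : 0 < s := by linarith
  have h1 := Real.rpow_sum_le_const_mul_sum_rpow S h hs
  have hc : (0 : ℝ) ≤ S.card := Nat.cast_nonneg _
  have h2 : (∑ x ∈ S, |h x|) ^ s ≤ (D * (S.card : ℝ) ^ (1 - 1 / s)) ^ s := by
    rw [Real.mul_rpow hD (by positivity), ← Real.rpow_mul hc,
      show (1 - 1 / s) * s = s - 1 by field_simp, mul_comm]
    exact h1.trans (by gcongr)
  exact (Real.rpow_le_rpow_iff (Finset.sum_nonneg fun _ _ => abs_nonneg _) (by positivity)
    hs0).1 h2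

theorem sum_abs_le_of_norm_le {p : ℝ≥0∞} (hp : 1 ≤ p) {δ : ℝ} (hδ : 0 ≤ δ)
    (ξ : lp (fun _ : ℕ × ℕ => ℝ) p) (hξ : ‖ξ‖ ≤ δ) (S : Finset (ℕ × ℕ)) :
    ∑ x ∈ S, |ξ x| ≤ δ * (S.card : ℝ) ^ (1 - (p⁻¹).toReal) := by
  by_cases hpt : p = ⊤
  · subst hpt
    simp only [ENNReal.inv_top, ENNReal.toReal_zero, sub_zero, Real.rpow_one]
    refine (Finset.sum_le_card_nsmul _ _ δ fun x _ => ?_).trans (by rw [nsmul_eq_mul, mul_comm])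
    exact (lp.norm_apply_le_norm (by simp) ξ x).trans hξ
  · have hp1 : 1 ≤ p.toReal := by
      rw [← ENNReal.toReal_one]
      exact ENNReal.toReal_mono hpt hp
    rw [ENNReal.toReal_inv, ← one_div]
    refine sum_abs_le_mul_card_rpow hp1 hδ S _ ?_
    have h := lp.sum_rpow_le_norm_rpow (by linarith : 0 < p.toReal) ξ S
    simp only [Real.norm_eq_abs] at h
    exact h.trans (Real.rpow_le_rpow (lp.norm_nonneg' ξ) hξ (by linarith))

theorem sum_weighted_coeff_le {s μ : ℝ} (hs : 1 ≤ s) {f : L2Q} (hf : f ∈ unitBall s μ)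
    (S : Finset (ℕ × ℕ)) :
    ∑ x ∈ S, |(((max 1 x.1 * max 1 x.2 : ℕ) : ℝ)) ^ μ * coeff f x.1 x.2| ≤
      1 * (S.card : ℝ) ^ (1 - 1 / s) := by
  refine sum_abs_le_mul_card_rpow hs zero_le_one S _ ?_
  obtain ⟨hsum, hle⟩ := hf
  have hnn : ∀ x, 0 ≤ smoothnessTerm s μ f x := fun x => by
    unfold smoothnessTerm
    positivity
  have h1 : ∑' x, smoothnessTerm s μ f x ≤ 1 := by
    by_contra hlt
    exact absurd hle (not_le.2 (Real.one_lt_rpow (not_le.1 hlt) (by positivity)))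
  rw [Real.one_rpow]
  refine le_trans (le_of_eq ?_) ((hsum.sum_le_tsum S fun x _ => hnn x).trans h1)
  refine Finset.sum_congr rfl fun x _ => ?_
  rw [smoothnessTerm, abs_mul, Real.mul_rpow (abs_nonneg _) (abs_nonneg _),
    abs_of_nonneg (by positivity), ← Real.rpow_mul (Nat.cast_nonneg _), mul_comm μ s]

theorem le_of_sq_le_mul_rpow {x C n Λ a κ : ℝ} (hC : 0 ≤ C) (hn : 0 < n) (hΛ : 0 < Λ)
    (h : x ^ 2 ≤ C * n ^ (2 * a) * Λ ^ κ) : x ≤ Real.sqrt C * n ^ a * Λ ^ (κ / 2) := by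
  refine le_of_abs_le (abs_le_of_sq_le_sq (h.trans (le_of_eq ?_)) (by positivity))
  rw [mul_pow, mul_pow, Real.sq_sqrt hC, ← Real.rpow_natCast (n ^ a), ← Real.rpow_mul hn.le,
    ← Real.rpow_natCast (Λ ^ (κ / 2)), ← Real.rpow_mul hΛ.le]
  congr 2
  · congr 1; push_cast; ring
  · push_cast; ring

theorem one_add_posLog_pos (n : ℝ) : 0 < 1 + Real.posLog n := by
  have : 0 ≤ Real.posLog n := Real.posLog_nonneg
  linarith

theorem two_rpow_le_of_mem_image {F : Finset (ℕ × ℕ)} (hF : ∀ x ∈ F, 1 ≤ x.1 ∧ 1 ≤ x.2)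
    {γ : ℝ} (hγ : 0 < γ) {u : ℕ × ℕ} (hu : u ∈ F.image dyadicBlock) :
    ∃ x ∈ F, (2 : ℝ) ^ (u.1 : ℝ) * ((2 : ℝ) ^ (u.2 : ℝ)) ^ γ ≤ x.1 * (x.2 : ℝ) ^ γ ∧
      x.1 * (x.2 : ℝ) ^ γ ≤
        (2 * 2 ^ γ) * ((2 : ℝ) ^ (u.1 : ℝ) * ((2 : ℝ) ^ (u.2 : ℝ)) ^ γ) := by
  obtain ⟨x, hx, rfl⟩ := Finset.mem_image.1 hu
  obtain ⟨h1, h2⟩ := hF x hx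
  obtain ⟨h3, h4⟩ := two_pow_le_and_lt h1 rfl
  obtain ⟨h5, h6⟩ := two_pow_le_and_lt h2 rfl
  have h3' : (2 : ℝ) ^ Nat.log 2 x.1 ≤ x.1 := by exact_mod_cast h3
  have h4' : (x.1 : ℝ) ≤ 2 * 2 ^ Nat.log 2 x.1 := by
    rw [mul_comm, ← pow_succ]; exact_mod_cast h4.le
  have h5' : (2 : ℝ) ^ Nat.log 2 x.2 ≤ x.2 := by exact_mod_cast h5
  have h6' : (x.2 : ℝ) ≤ 2 * 2 ^ Nat.log 2 x.2 := by
    rw [mul_comm, ← pow_succ]; exact_mod_cast h6.le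
  refine ⟨x, hx, ?_, ?_⟩
  · simp only [dyadicBlock, Real.rpow_natCast]
    gcongr
  · simp only [dyadicBlock, Real.rpow_natCast]
    calc (x.1 : ℝ) * (x.2 : ℝ) ^ γ
        ≤ (2 * 2 ^ Nat.log 2 x.1) * (2 * 2 ^ Nat.log 2 x.2) ^ γ := by gcongr
      _ = _ := by rw [Real.mul_rpow zero_le_two (by positivity)]; ring

/-- The part of the series for the derivative outside the hyperbolic cross. -/
theorem norm_sum_outside_cross_le {r₁ r₂ : ℕ} (h₁ : 1 ≤ r₁) (h₂ : 1 ≤ r₂) {s μ α₁ α₂ γ κ : ℝ}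
    (hs : 1 ≤ s) (hα₁ : α₁ = μ - 2 * (r₁ : ℝ) + 1 / s - 1 / 2)
    (hα₂ : α₂ = μ - 2 * (r₂ : ℝ) + 1 / s - 1 / 2) (hp₁ : 0 < α₁) (hp₂ : 0 < α₂) (hγ : 0 < γ)
    (hκ : (γ * α₁ < α₂ ∧ κ = 0) ∨ (γ * α₁ = α₂ ∧ κ = 1)) :
    ∃ C : ℝ, 0 < C ∧ ∀ n : ℝ, 0 < n → ∀ f ∈ unitBall s μ, ∀ F : Finset (ℕ × ℕ),
      (∀ x ∈ F, 1 ≤ x.1 ∧ 1 ≤ x.2) → (∀ x ∈ F, n ≤ x.1 * (x.2 : ℝ) ^ γ) →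
      ‖∑ x ∈ F, mixedDerivTerm r₁ r₂ f x‖ ≤ C * n ^ (-α₁) * (1 + Real.posLog n) ^ (κ / 2) := by
  have hs1 : 1 / s ≤ 1 := by rw [div_le_one (by linarith)]; exact hs
  obtain ⟨C, hC, H⟩ := norm_sum_derivProd_sq_le h₁ h₂ μ (1 / s) hs1
  obtain ⟨C', hC', H'⟩ := sum_outside_cross_le (θ₁ := 2 * α₁) (θ₂ := 2 * α₂) (γ := γ) (κ := κ)
    (by linarith) (by linarith) hγ
    (hκ.imp (fun h => ⟨by linarith [h.1], h.2⟩) (fun h => ⟨by linarith [h.1], h.2⟩))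
  have hκ0 : 0 ≤ κ := by rcases hκ with h | h <;> simp [h.2]
  set b : ℝ := 2 * 2 ^ γ with hb
  have hb1 : 1 ≤ b := by
    have := Real.one_le_rpow (x := 2) one_le_two hγ.le
    linarith
  have hb0 : 0 < b := by linarith
  refine ⟨Real.sqrt (C * C' * b ^ (2 * α₁)), by positivity, fun n hn f hf F hF hFn => ?_⟩
  apply le_of_sq_le_mul_rpow (by positivity) hn (one_add_posLog_pos n)
  have hH := H 1 zero_le_one
    (fun x => (((max 1 x.1 * max 1 x.2 : ℕ) : ℝ)) ^ μ * coeff f x.1 x.2)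
    (fun x => coeff f x.1 x.2) (sum_weighted_coeff_le hs hf) F hF (fun x hx => by
      obtain ⟨h1, h2⟩ := hF x hx
      have hp1 : (0 : ℝ) < x.1 := by exact_mod_cast h1
      have hp2 : (0 : ℝ) < x.2 := by exact_mod_cast h2
      rw [max_eq_right h1, max_eq_right h2, abs_mul,
        abs_of_nonneg (by positivity : (0 : ℝ) ≤ ((x.1 * x.2 : ℕ) : ℝ) ^ μ), Nat.cast_mul,
        Real.mul_rpow hp1.le hp2.le, Real.rpow_neg hp1.le, Real.rpow_neg hp2.le]
      field_simp)
  have hN : 0 < n / b := by positivity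
  have hH' := H' (n / b) hN (F.image dyadicBlock) (fun u hu => by
    obtain ⟨x, hx, -, hx2⟩ := two_rpow_le_of_mem_image hF hγ hu
    rw [div_le_iff₀' hb0]
    exact (hFn x hx).trans hx2)
  have e1 : 2 * (2 * (r₁ : ℝ) + 1 / 2 - μ - 1 / s) = -(2 * α₁) := by rw [hα₁]; ring
  have e2 : 2 * (2 * (r₂ : ℝ) + 1 / 2 - μ - 1 / s) = -(2 * α₂) := by rw [hα₂]; ring
  rw [e1, e2] at hH
  have hlog : Real.posLog (n / b) ≤ Real.posLog n :=
    Real.monotoneOn_posLog hN.le hn.le (div_le_self hn.le hb1)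
  have hΛ := one_add_posLog_pos (n / b)
  calc _ ≤ C * 1 ^ 2 * _ := hH
    _ ≤ C * 1 ^ 2 * (C' * (n / b) ^ (-(2 * α₁)) * (1 + Real.posLog (n / b)) ^ κ) := by gcongr
    _ ≤ C * 1 ^ 2 * (C' * (n / b) ^ (-(2 * α₁)) * (1 + Real.posLog n) ^ κ) := by gcongr
    _ = _ := by
      rw [Real.div_rpow hn.le hb0.le, Real.rpow_neg hb0.le, div_inv_eq_mul, mul_neg]
      ring

/-- The noise in the coefficients used by the truncation method. -/
theorem norm_sum_inside_cross_le {r₁ r₂ : ℕ} (h₁ : 1 ≤ r₁) (h₂ : 1 ≤ r₂) {q β₁ β₂ γ κ : ℝ}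
    (hq : q ≤ 1) (hβ₁ : β₁ = 2 * (r₁ : ℝ) + 1 / 2 - q)
    (hβ₂ : β₂ = 2 * (r₂ : ℝ) + 1 / 2 - q) (hγ : 0 < γ)
    (hκ : (β₂ < γ * β₁ ∧ κ = 0) ∨ (β₂ = γ * β₁ ∧ κ = 1)) :
    ∃ C : ℝ, 0 < C ∧ ∀ n : ℝ, 0 < n → ∀ δ : ℝ, 0 ≤ δ → ∀ ξ : ℕ × ℕ → ℝ,
      (∀ S : Finset (ℕ × ℕ), ∑ x ∈ S, |ξ x| ≤ δ * (S.card : ℝ) ^ (1 - q)) →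
      ∀ F : Finset (ℕ × ℕ), (∀ x ∈ F, 1 ≤ x.1 ∧ 1 ≤ x.2) →
      (∀ x ∈ F, x.1 * (x.2 : ℝ) ^ γ ≤ n) →
      ‖∑ x ∈ F, ξ x • derivProd r₁ r₂ x.1 x.2‖ ≤
        C * (δ * n ^ β₁ * (1 + Real.posLog n) ^ (κ / 2)) := by
  obtain ⟨C, hC, H⟩ := norm_sum_derivProd_sq_le h₁ h₂ 0 q hq
  have hr : (1 : ℝ) ≤ r₁ := by exact_mod_cast h₁
  obtain ⟨C', hC', H'⟩ := sum_inside_cross_le (θ₁ := 2 * β₁) (θ₂ := 2 * β₂) (γ := γ) (κ := κ)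
    (by rw [hβ₁]; linarith) hγ
    (hκ.imp (fun h => ⟨by linarith [h.1], h.2⟩) (fun h => ⟨by linarith [h.1], h.2⟩))
  refine ⟨Real.sqrt (C * C'), by positivity, fun n hn δ hδ ξ hξ F hF hFn => ?_⟩
  have hH := H δ hδ ξ ξ hξ F hF (fun x _ => by simp)
  have hH' := H' n hn (F.image dyadicBlock) (fun u hu => by
    obtain ⟨x, hx, hx1, -⟩ := two_rpow_le_of_mem_image hF hγ hu
    exact hx1.trans (hFn x hx))
  have e1 : 2 * (2 * (r₁ : ℝ) + 1 / 2 - 0 - q) = 2 * β₁ := by rw [hβ₁]; ring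
  have e2 : 2 * (2 * (r₂ : ℝ) + 1 / 2 - 0 - q) = 2 * β₂ := by rw [hβ₂]; ring
  rw [e1, e2] at hH
  have h : ‖∑ x ∈ F, ξ x • derivProd r₁ r₂ x.1 x.2‖ ^ 2 ≤
      (C * C' * δ ^ 2) * n ^ (2 * β₁) * (1 + Real.posLog n) ^ κ :=
    calc _ ≤ C * δ ^ 2 * _ := hH
      _ ≤ C * δ ^ 2 * (C' * n ^ (2 * β₁) * (1 + Real.posLog n) ^ κ) := by gcongr
      _ = _ := by ring
  refine (le_of_sq_le_mul_rpow (by positivity) hn (one_add_posLog_pos n) h).trans (le_of_eq ?_)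
  rw [Real.sqrt_mul (by positivity), Real.sqrt_sq hδ]
  ring

theorem mem_cross {r₁ r₂ : ℕ} (h₁ : 1 ≤ r₁) (h₂ : 1 ≤ r₂) {n γ : ℝ} (hγ : 0 < γ)
    {x : ℕ × ℕ} :
    x ∈ cross r₁ r₂ n γ ↔ (r₁ ≤ x.1 ∧ r₂ ≤ x.2) ∧ (x.1 : ℝ) * (x.2 : ℝ) ^ γ ≤ n := by
  have hr₁ : (0 : ℝ) < r₁ := by exact_mod_cast h₁
  have hr₂ : (0 : ℝ) < r₂ := by exact_mod_cast h₂
  simp only [cross, Finset.mem_filter, Finset.mem_product, Finset.mem_Icc]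
  refine ⟨fun h => ⟨⟨h.1.1.1, h.1.2.1⟩, h.2⟩, fun ⟨⟨h3, h4⟩, h5⟩ => ⟨⟨⟨h3, ?_⟩, h4, ?_⟩, h5⟩⟩
  · refine Nat.le_floor ?_
    rw [le_div_iff₀ (by positivity)]
    refine le_trans ?_ h5
    gcongr
  · refine Nat.le_floor ?_
    have h6 : (x.2 : ℝ) ^ γ ≤ n / r₁ := by
      rw [le_div_iff₀' hr₁]
      refine le_trans ?_ h5
      gcongr
    have h7 := Real.rpow_le_rpow (by positivity) h6 (by positivity : 0 ≤ 1 / γ)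
    rwa [← Real.rpow_mul (Nat.cast_nonneg _), mul_one_div_cancel hγ.ne', Real.rpow_one] at h7

/-- Terms below the orders of differentiation vanish, so that only the hyperbolic condition
matters for index sets that avoid the cross. -/
theorem norm_sum_mixedDerivTerm_le_of_disjoint {r₁ r₂ : ℕ} (h₁ : 1 ≤ r₁) (h₂ : 1 ≤ r₂)
    {n γ B : ℝ} (hγ : 0 < γ) {f : L2Q}
    (hB : ∀ F : Finset (ℕ × ℕ), (∀ x ∈ F, 1 ≤ x.1 ∧ 1 ≤ x.2) →
      (∀ x ∈ F, n ≤ x.1 * (x.2 : ℝ) ^ γ) → ‖∑ x ∈ F, mixedDerivTerm r₁ r₂ f x‖ ≤ B)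
    {F : Finset (ℕ × ℕ)} (hF : Disjoint F (cross r₁ r₂ n γ)) :
    ‖∑ x ∈ F, mixedDerivTerm r₁ r₂ f x‖ ≤ B := by
  have h0 : ∀ x ∈ F, mixedDerivTerm r₁ r₂ f x ≠ 0 → r₁ ≤ x.1 ∧ r₂ ≤ x.2 := by
    intro x _ hx
    by_contra hlt
    refine hx ?_
    rw [mixedDerivTerm, derivProd_eq_zero (by omega), smul_zero]
  rw [← Finset.sum_filter_of_ne h0]
  refine hB _ (fun x hx => ?_) (fun x hx => ?_)
  · have := (Finset.mem_filter.1 hx).2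
    exact ⟨h₁.trans this.1, h₂.trans this.2⟩
  · obtain ⟨hxF, hx⟩ := Finset.mem_filter.1 hx
    by_contra hlt
    exact Finset.disjoint_left.1 hF hxF ((mem_cross h₁ h₂ hγ).2 ⟨hx, (not_le.1 hlt).le⟩)

theorem summable_mixedDerivTerm {r₁ r₂ : ℕ} (h₁ : 1 ≤ r₁) (h₂ : 1 ≤ r₂) (h₂₁ : r₂ ≤ r₁)
    {s μ : ℝ} (hs : 1 ≤ s) (hμ : 2 * (r₁ : ℝ) + 1 / 2 - 1 / s < μ) {f : L2Q}
    (hf : f ∈ unitBall s μ) : Summable (mixedDerivTerm r₁ r₂ f) := by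
  have hr : (r₂ : ℝ) ≤ r₁ := by exact_mod_cast h₂₁
  have hp₁ : 0 < μ - 2 * (r₁ : ℝ) + 1 / s - 1 / 2 := by linarith
  -- Any slope below `α₂ / α₁` gives a tail estimate without logarithm; `1 / 2` always qualifies.
  obtain ⟨C, hC, H⟩ := norm_sum_outside_cross_le (γ := 1 / 2) (κ := 0) h₁ h₂ hs rfl rfl hp₁
    (by linarith) (by norm_num) (Or.inl ⟨by linarith, rfl⟩)
  rw [summable_iff_vanishing_norm]
  intro ε hε
  have hlim := (tendsto_rpow_neg_atTop hp₁).const_mul C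
  rw [mul_zero] at hlim
  obtain ⟨n, hn, hn0⟩ := ((hlim.eventually (gt_mem_nhds hε)).and
    (Filter.eventually_gt_atTop 0)).exists
  refine ⟨cross r₁ r₂ n (1 / 2), fun t ht => lt_of_le_of_lt ?_ hn⟩
  refine norm_sum_mixedDerivTerm_le_of_disjoint h₁ h₂ (by norm_num) (fun F hF hFn => ?_) ht
  simpa using H n hn0 f hf F hF hFn

/-- The error splits into the part of the series outside the cross and the noise inside. -/
theorem norm_mixedDeriv_sub_truncation_le {r₁ r₂ : ℕ} (h₁ : 1 ≤ r₁) (h₂ : 1 ≤ r₂)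
    (h₂₁ : r₂ ≤ r₁) {s μ : ℝ} (hs : 1 ≤ s) (hμ : 2 * (r₁ : ℝ) + 1 / 2 - 1 / s < μ) {p : ℝ≥0∞}
    (hp : 1 ≤ p) {q α₁ α₂ β₁ β₂ γ κ κ' : ℝ} (hq : q = (p⁻¹).toReal)
    (hα₁ : α₁ = μ - 2 * (r₁ : ℝ) + 1 / s - 1 / 2) (hα₂ : α₂ = μ - 2 * (r₂ : ℝ) + 1 / s - 1 / 2)
    (hβ₁ : β₁ = 2 * (r₁ : ℝ) + 1 / 2 - q) (hβ₂ : β₂ = 2 * (r₂ : ℝ) + 1 / 2 - q) (hγ : 0 < γ)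
    (hκ : (γ * α₁ < α₂ ∧ κ = 0) ∨ (γ * α₁ = α₂ ∧ κ = 1))
    (hκ' : (β₂ < γ * β₁ ∧ κ' = 0) ∨ (β₂ = γ * β₁ ∧ κ' = 1)) :
    ∃ C : ℝ, 0 < C ∧ ∀ n : ℝ, 0 < n → ∀ δ : ℝ, 0 ≤ δ → ∀ f ∈ unitBall s μ, ∀ y : ℕ × ℕ → ℝ,
      IsPerturbation p δ f y →
      ‖mixedDeriv r₁ r₂ f - truncation r₁ r₂ n γ y‖ ≤
        C * (n ^ (-α₁) * (1 + Real.posLog n) ^ (κ / 2) +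
          δ * n ^ β₁ * (1 + Real.posLog n) ^ (κ' / 2)) := by
  classical
  have hr : (r₂ : ℝ) ≤ r₁ := by exact_mod_cast h₂₁
  have hq1 : q ≤ 1 := by
    rw [hq, ← ENNReal.toReal_one]
    exact ENNReal.toReal_mono ENNReal.one_ne_top (ENNReal.inv_le_one.2 hp)
  obtain ⟨C, hC, H⟩ := norm_sum_outside_cross_le h₁ h₂ hs hα₁ hα₂ (by linarith) (by linarith)
    hγ hκ
  obtain ⟨C', hC', H'⟩ := norm_sum_inside_cross_le h₁ h₂ hq1 hβ₁ hβ₂ hγ hκ'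
  refine ⟨C + C', by positivity, fun n hn δ hδ f hf y hy => ?_⟩
  obtain ⟨ξ, hξ, hξδ⟩ := hy
  have hΛ := one_add_posLog_pos n
  have hnoise := H' n hn δ hδ ξ
    (fun S => by rw [hq]; exact sum_abs_le_of_norm_le hp hδ ξ hξδ S) (cross r₁ r₂ n γ)
    (fun x hx => by
      obtain ⟨⟨h3, h4⟩, -⟩ := (mem_cross h₁ h₂ hγ).1 hx
      exact ⟨h₁.trans h3, h₂.trans h4⟩)
    (fun x hx => ((mem_cross h₁ h₂ hγ).1 hx).2)
  have hlim : Filter.Tendsto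
      (fun F : Finset (ℕ × ℕ) => ‖∑ x ∈ F, mixedDerivTerm r₁ r₂ f x - truncation r₁ r₂ n γ y‖)
      Filter.atTop (nhds ‖mixedDeriv r₁ r₂ f - truncation r₁ r₂ n γ y‖) :=
    ((summable_mixedDerivTerm h₁ h₂ h₂₁ hs hμ hf).hasSum.sub_const _).norm
  refine le_of_tendsto hlim ?_
  filter_upwards [Filter.eventually_ge_atTop (cross r₁ r₂ n γ)] with F hF
  have hsplit : ∑ x ∈ F, mixedDerivTerm r₁ r₂ f x - truncation r₁ r₂ n γ y =
      ∑ x ∈ F \ cross r₁ r₂ n γ, mixedDerivTerm r₁ r₂ f x +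
        ∑ x ∈ cross r₁ r₂ n γ, ξ x • derivProd r₁ r₂ x.1 x.2 := by
    rw [← Finset.sum_sdiff hF, add_sub_assoc, truncation, ← Finset.sum_sub_distrib]
    congr 1
    refine Finset.sum_congr rfl fun x _ => ?_
    rw [hξ, mixedDerivTerm, sub_smul]
  have htail := norm_sum_mixedDerivTerm_le_of_disjoint h₁ h₂ hγ (H n hn f hf)
    (Finset.sdiff_disjoint (s := cross r₁ r₂ n γ) (t := F))
  rw [hsplit]
  refine (norm_add_le _ _).trans ((add_le_add htail hnoise).trans ?_)
  have t1 : 0 ≤ n ^ (-α₁) * (1 + Real.posLog n) ^ (κ / 2) := by positivity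
  have t2 : 0 ≤ δ * n ^ β₁ * (1 + Real.posLog n) ^ (κ' / 2) := by positivity
  nlinarith [mul_nonneg hC'.le t1, mul_nonneg hC.le t2]

/-! ### Balancing the two errors -/

theorem log_one_div_pos {δ : ℝ} (h0 : 0 < δ) (h1 : δ < 1) : 0 < Real.log (1 / δ) :=
  Real.log_pos ((one_lt_div h0).2 h1)

/-- If `n` is at most of order `(δ / ln^e (1/δ))^(-1/E)`, then `ln n` is at most of
order `ln (1/δ)`, as long as `δ` stays away from `1`. -/
theorem one_add_posLog_le_mul_log {E e B δ₀ : ℝ} (hE : 0 < E) (hB : 0 < B) (h0 : 0 < δ₀)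
    (h1 : δ₀ < 1) :
    ∃ c : ℝ, 0 < c ∧ ∀ δ : ℝ, 0 < δ → δ < δ₀ → ∀ n : ℝ, 0 < n →
      n ≤ B * (δ / Real.log (1 / δ) ^ e) ^ (-(1 / E)) →
      1 + Real.posLog n ≤ c * Real.log (1 / δ) := by
  set L₀ := Real.log (1 / δ₀) with hL₀
  have hL₀pos : 0 < L₀ := log_one_div_pos h0 h1
  set K : ℝ := 1 + |Real.log B| + |e| * |Real.log L₀| / E with hK
  have hK1 : 0 < K := by positivity
  refine ⟨K / L₀ + (1 + |e|) / E, by positivity, fun δ hδ hδ₀ n hn hnB => ?_⟩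
  have hLpos : 0 < Real.log (1 / δ) := log_one_div_pos hδ (hδ₀.trans h1)
  have hLL : L₀ ≤ Real.log (1 / δ) :=
    Real.log_le_log (by positivity) (one_div_le_one_div_of_le hδ hδ₀.le)
  have hδL : Real.log δ = -Real.log (1 / δ) := by
    rw [one_div, Real.log_inv, neg_neg]
  set L := Real.log (1 / δ) with hL
  have hLe : 0 < L ^ e := by positivity
  have hlog : Real.log n ≤ Real.log B + (L + e * Real.log L) / E := by
    have h := Real.log_le_log hn hnB
    rw [Real.log_mul hB.ne' (by positivity), Real.log_rpow (by positivity),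
      Real.log_div hδ.ne' hLe.ne', Real.log_rpow hLpos, hδL] at h
    refine h.trans (le_of_eq ?_)
    field_simp
    ring
  have hlogL : |Real.log L| ≤ L + |Real.log L₀| := by
    rw [abs_le]
    constructor
    · have h2 := Real.log_le_log hL₀pos hLL
      have h3 := neg_abs_le (Real.log L₀)
      linarith
    · have h2 := Real.log_le_sub_one_of_pos hLpos
      have h3 := abs_nonneg (Real.log L₀)
      linarith
  have heL : e * Real.log L ≤ |e| * (L + |Real.log L₀|) :=
    (le_abs_self _).trans ((abs_mul _ _).le.trans
      (mul_le_mul_of_nonneg_left hlogL (abs_nonneg e)))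
  have hdiv : (L + e * Real.log L) / E ≤ (L + |e| * (L + |Real.log L₀|)) / E := by gcongr
  have hKL : K ≤ K / L₀ * L := by
    rw [div_mul_eq_mul_div, le_div_iff₀ hL₀pos]
    gcongr
  have hpos : Real.posLog n ≤ |Real.log B| + (L + |e| * (L + |Real.log L₀|)) / E := by
    refine max_le (by positivity) ?_
    have := le_abs_self (Real.log B)
    linarith
  have hsplit : (L + |e| * (L + |Real.log L₀|)) / E =
      (1 + |e|) / E * L + |e| * |Real.log L₀| / E := by ring
  rw [add_mul]
  linarith

theorem rpow_le_mul_rpow_of_le {L L₀ a b : ℝ} (h0 : 0 < L₀) (h : L₀ ≤ L) (hab : a ≤ b) :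
    L ^ a ≤ L₀ ^ (a - b) * L ^ b := by
  have hL : 0 < L := h0.trans_le h
  calc L ^ a = L ^ (a - b) * L ^ b := by rw [← Real.rpow_add hL]; congr 1; ring
    _ ≤ _ := mul_le_mul_of_nonneg_right
      (Real.rpow_le_rpow_of_nonpos h0 h (by linarith)) (by positivity)

/-- The parameter choice `n ≍ x^(-1/E)`, `x = δ / ln^e (1/δ)`, balances the two errors: both
become `x^(α₁/E)` up to logarithms, because `β₁ = E - α₁`. The logarithmic factors are
compared with `ln^g (1/δ)` in the hypothesis `hlog`. -/
theorem errorEstimate_of_log_le {r₁ r₂ : ℕ} (h₁ : 1 ≤ r₁) (h₂ : 1 ≤ r₂) (h₂₁ : r₂ ≤ r₁)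
    {s μ : ℝ} (hs : 1 ≤ s) (hμ : 2 * (r₁ : ℝ) + 1 / 2 - 1 / s < μ) {p : ℝ≥0∞} (hp : 1 ≤ p)
    {q E α₁ α₂ β₁ β₂ γ κ κ' e g δ₀ : ℝ} (hq : q = (p⁻¹).toReal) (hE : E = μ - q + 1 / s)
    (hα₁ : α₁ = μ - 2 * (r₁ : ℝ) + 1 / s - 1 / 2) (hα₂ : α₂ = μ - 2 * (r₂ : ℝ) + 1 / s - 1 / 2)
    (hβ₁ : β₁ = 2 * (r₁ : ℝ) + 1 / 2 - q) (hβ₂ : β₂ = 2 * (r₂ : ℝ) + 1 / 2 - q) (hγ : 0 < γ)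
    (hκ : (γ * α₁ < α₂ ∧ κ = 0) ∨ (γ * α₁ = α₂ ∧ κ = 1))
    (hκ' : (β₂ < γ * β₁ ∧ κ' = 0) ∨ (β₂ = γ * β₁ ∧ κ' = 1)) (hβ : 0 < β₁) (hδ₀ : δ₀ ≤ 1)
    {ν ε : ℝ → ℝ}
    (hν : ∀ δ, 0 < δ → δ < δ₀ → ν δ = (δ / Real.log (1 / δ) ^ e) ^ (-(1 / E)))
    (hε : ∀ δ, 0 < δ → δ < δ₀ →
      ε δ = (δ / Real.log (1 / δ) ^ e) ^ (α₁ / E) * Real.log (1 / δ) ^ g)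
    (hlog : ∀ B : ℝ, 0 < B → ∃ c : ℝ, 0 < c ∧ ∀ δ : ℝ, 0 < δ → δ < δ₀ → ∀ n : ℝ, 0 < n →
      n ≤ B * (δ / Real.log (1 / δ) ^ e) ^ (-(1 / E)) →
      (1 + Real.posLog n) ^ (κ / 2) ≤ c * Real.log (1 / δ) ^ g ∧
      Real.log (1 / δ) ^ e * (1 + Real.posLog n) ^ (κ' / 2) ≤ c * Real.log (1 / δ) ^ g) :
    ErrorEstimate r₁ r₂ s μ p γ δ₀ ν ε := by
  intro A B hA hAB
  have hB : 0 < B := hA.trans_le hAB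
  have hEα : E = α₁ + β₁ := by rw [hE, hα₁, hβ₁]; ring
  have hα : 0 < α₁ := by rw [hα₁]; linarith
  have hE0 : 0 < E := by linarith
  obtain ⟨C, hC, H⟩ := norm_mixedDeriv_sub_truncation_le h₁ h₂ h₂₁ hs hμ hp hq hα₁ hα₂ hβ₁ hβ₂
    hγ hκ hκ'
  obtain ⟨c, hc, hc'⟩ := hlog B hB
  refine ⟨C * (A ^ (-α₁) * c + B ^ β₁ * c), by positivity, fun δ hδ hδ1 n hnA hnB f hf y hy => ?_⟩
  have hL : 0 < Real.log (1 / δ) := log_one_div_pos hδ (hδ1.trans_le hδ₀)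
  rw [hν δ hδ hδ1] at hnA hnB
  rw [hε δ hδ hδ1]
  set L := Real.log (1 / δ) with hLdef
  have hLe : 0 < L ^ e := by positivity
  set x := δ / L ^ e with hx
  have hx0 : 0 < x := by positivity
  have hn : 0 < n := lt_of_lt_of_le (by positivity) hnA
  obtain ⟨hl1, hl2⟩ := hc' δ hδ hδ1 n hn hnB
  have hΛ := one_add_posLog_pos n
  have hn1 : n ^ (-α₁) ≤ A ^ (-α₁) * x ^ (α₁ / E) := by
    refine (Real.rpow_le_rpow_of_nonpos (by positivity) hnA (by linarith)).trans (le_of_eq ?_)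
    rw [Real.mul_rpow hA.le (by positivity), ← Real.rpow_mul hx0.le]
    congr 2
    ring
  have hn2 : δ * n ^ β₁ ≤ B ^ β₁ * (x ^ (α₁ / E) * L ^ e) := by
    calc δ * n ^ β₁ ≤ δ * (B * x ^ (-(1 / E))) ^ β₁ := by gcongr
      _ = B ^ β₁ * (x ^ (α₁ / E) * L ^ e) := by
        have hδx : δ = x * L ^ e := by rw [hx]; field_simp
        rw [Real.mul_rpow hB.le (by positivity), ← Real.rpow_mul hx0.le, hδx,
          show α₁ / E = 1 + -(1 / E) * β₁ by rw [hEα]; rw [hEα] at hE0; field_simp; ring,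
          Real.rpow_add hx0, Real.rpow_one]
        ring
  refine (H n hn δ hδ.le f hf y hy).trans ?_
  calc C * (n ^ (-α₁) * (1 + Real.posLog n) ^ (κ / 2) +
        δ * n ^ β₁ * (1 + Real.posLog n) ^ (κ' / 2))
      ≤ C * (A ^ (-α₁) * x ^ (α₁ / E) * (c * L ^ g) +
        B ^ β₁ * (x ^ (α₁ / E) * L ^ e) * (1 + Real.posLog n) ^ (κ' / 2)) := by gcongr
    _ = C * (A ^ (-α₁) * x ^ (α₁ / E) * (c * L ^ g) +
        B ^ β₁ * x ^ (α₁ / E) * (L ^ e * (1 + Real.posLog n) ^ (κ' / 2))) := by ring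
    _ ≤ C * (A ^ (-α₁) * x ^ (α₁ / E) * (c * L ^ g) +
        B ^ β₁ * x ^ (α₁ / E) * (c * L ^ g)) := by gcongr
    _ = _ := by ring

/-- The comparison of logarithmic factors for `δ` away from `1`. -/
theorem log_factors_le {E e g κ κ' δ₀ B : ℝ} (hE : 0 < E) (hδ₀ : δ₀ < 1) (hB : 0 < B)
    (hκ0 : 0 ≤ κ) (hκ0' : 0 ≤ κ') (hκg : κ / 2 ≤ g) (hκg' : e + κ' / 2 ≤ g) :
    ∃ c : ℝ, 0 < c ∧ ∀ δ : ℝ, 0 < δ → δ < δ₀ → ∀ n : ℝ, 0 < n →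
      n ≤ B * (δ / Real.log (1 / δ) ^ e) ^ (-(1 / E)) →
      (1 + Real.posLog n) ^ (κ / 2) ≤ c * Real.log (1 / δ) ^ g ∧
      Real.log (1 / δ) ^ e * (1 + Real.posLog n) ^ (κ' / 2) ≤ c * Real.log (1 / δ) ^ g := by
  rcases le_or_gt δ₀ 0 with h0 | h0
  · exact ⟨1, one_pos, fun δ hδ hδ1 => absurd (hδ.trans hδ1) (not_lt.2 h0)⟩
  obtain ⟨c, hc, H⟩ := one_add_posLog_le_mul_log (e := e) hE hB h0 hδ₀
  set L₀ := Real.log (1 / δ₀) with hL₀def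
  have hL₀ : 0 < L₀ := log_one_div_pos h0 hδ₀
  refine ⟨c ^ (κ / 2) * L₀ ^ (κ / 2 - g) + c ^ (κ' / 2) * L₀ ^ (e + κ' / 2 - g), by positivity,
    fun δ hδ hδ1 n hn hnB => ?_⟩
  have hLL : L₀ ≤ Real.log (1 / δ) :=
    Real.log_le_log (by positivity) (one_div_le_one_div_of_le hδ hδ1.le)
  have hΛ := H δ hδ hδ1 n hn hnB
  have hΛ0 := one_add_posLog_pos n
  set L := Real.log (1 / δ) with hLdef
  have hL : 0 < L := hL₀.trans_le hLL
  have hpow : ∀ t : ℝ, 0 ≤ t → (1 + Real.posLog n) ^ (t / 2) ≤ c ^ (t / 2) * L ^ (t / 2) := by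
    intro t ht
    rw [← Real.mul_rpow hc.le hL.le]
    exact Real.rpow_le_rpow hΛ0.le hΛ (by positivity)
  rw [add_mul]
  constructor
  · calc (1 + Real.posLog n) ^ (κ / 2) ≤ c ^ (κ / 2) * L ^ (κ / 2) := hpow κ hκ0
      _ ≤ c ^ (κ / 2) * (L₀ ^ (κ / 2 - g) * L ^ g) := by
        gcongr
        exact rpow_le_mul_rpow_of_le hL₀ hLL hκg
      _ ≤ _ := by
        rw [← mul_assoc]
        exact le_add_of_nonneg_right (by positivity)
  · calc L ^ e * (1 + Real.posLog n) ^ (κ' / 2) ≤ L ^ e * (c ^ (κ' / 2) * L ^ (κ' / 2)) := by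
          gcongr
          exact hpow κ' hκ0'
      _ = c ^ (κ' / 2) * L ^ (e + κ' / 2) := by rw [Real.rpow_add hL]; ring
      _ ≤ c ^ (κ' / 2) * (L₀ ^ (e + κ' / 2 - g) * L ^ g) := by
        gcongr
        exact rpow_le_mul_rpow_of_le hL₀ hLL hκg'
      _ ≤ _ := by
        rw [← mul_assoc]
        exact le_add_of_nonneg_left (by positivity)

end LegendreTruncation

theorem theorem1 (r₁ r₂ : ℕ) (hr₂ : 1 ≤ r₂) (hr : r₂ ≤ r₁) (s μ : ℝ) (hs : 1 ≤ s)
    (hμ : 2 * (r₁ : ℝ) + 1 / 2 - 1 / s < μ) (p : ℝ≥0∞) (hp : 1 ≤ p)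
    -- `q = 1 / p` (with `1 / ∞ = 0`)
    (q : ℝ) (hq : q = (p⁻¹).toReal)
    -- `E = μ - 1/p + 1/s`, `α₁ = μ - 2r₁ + 1/s - 1/2`, `α₂ = μ - 2r₂ + 1/s - 1/2`
    (E α₁ α₂ : ℝ) (hE : E = μ - q + 1 / s)
    (hα₁ : α₁ = μ - 2 * (r₁ : ℝ) + 1 / s - 1 / 2)
    (hα₂ : α₂ = μ - 2 * (r₂ : ℝ) + 1 / s - 1 / 2) :
    -- the series defining the derivative converges in `L₂`
    (∀ f ∈ unitBall s μ, Summable (mixedDerivTerm r₁ r₂ f)) ∧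
    -- I
    (r₁ = r₂ → ∀ δ₀ : ℝ, δ₀ < 1 →
      ErrorEstimate r₁ r₂ s μ p 1 δ₀
        (fun δ => (δ / Real.log (1 / δ) ^ (q - 1 / s)) ^ (-(1 / E)))
        (fun δ => (δ * Real.log (1 / δ) ^ (1 / s - q)) ^ (α₁ / E) *
          Real.log (1 / δ) ^ (3 / 2 - 1 / s))) ∧
    -- II a
    (r₂ < r₁ → ∀ γ : ℝ,
      γ ∈ Set.Ico 1 (α₂ / (α₁ + 1)) ∪ Set.Ioo (α₂ / (α₁ + 1)) ((α₂ + 1) / (α₁ + 1)) ∪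
        Set.Ioo ((α₂ + 1) / (α₁ + 1)) (α₂ / α₁) →
      ErrorEstimate r₁ r₂ s μ p γ 1
        (fun δ => δ ^ (-(1 / E)))
        (fun δ => δ ^ (α₁ / E))) ∧
    -- II b
    (r₂ < r₁ → ∀ γ : ℝ, γ = α₂ / (α₁ + 1) ∨ γ = α₂ / α₁ → ∀ δ₀ : ℝ, δ₀ < 1 →
      ErrorEstimate r₁ r₂ s μ p γ δ₀
        (fun δ => δ ^ (-(1 / E)) * Real.log (1 / δ) ^ (1 / (2 * E)))
        (fun δ => (δ / Real.log (1 / δ) ^ (1 / 2 : ℝ)) ^ (α₁ / E) *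
          Real.log (1 / δ) ^ (1 / 2 : ℝ))) ∧
    -- II c
    (r₂ < r₁ → ∀ γ : ℝ, γ = (α₂ + 1) / (α₁ + 1) → ∀ δ₀ : ℝ, δ₀ < 1 →
      ErrorEstimate r₁ r₂ s μ p γ δ₀
        (fun δ => (δ / Real.log (1 / δ) ^ (1 - 1 / s)) ^ (-(1 / E)))
        (fun δ => (δ / Real.log (1 / δ) ^ (1 - 1 / s)) ^ (α₁ / E) *
          Real.log (1 / δ) ^ (1 - 1 / s))) := by
  have hr₁ : 1 ≤ r₁ := hr₂.trans hr
  have hr₁' : (1 : ℝ) ≤ r₁ := by exact_mod_cast hr₁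
  have hr' : (r₂ : ℝ) ≤ r₁ := by exact_mod_cast hr
  have hs1 : 1 / s ≤ 1 := by rw [div_le_one (by linarith)]; exact hs
  have hq1 : q ≤ 1 := by
    rw [hq, ← ENNReal.toReal_one]
    exact ENNReal.toReal_mono ENNReal.one_ne_top (ENNReal.inv_le_one.2 hp)
  have hα₁0 : 0 < α₁ := by rw [hα₁]; linarith
  have hα₁1 : 0 < α₁ + 1 := by linarith
  obtain ⟨β₁, hβ₁⟩ : ∃ β₁, β₁ = 2 * (r₁ : ℝ) + 1 / 2 - q := ⟨_, rfl⟩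
  obtain ⟨β₂, hβ₂⟩ : ∃ β₂, β₂ = 2 * (r₂ : ℝ) + 1 / 2 - q := ⟨_, rfl⟩
  have hβ₁0 : 0 < β₁ := by rw [hβ₁]; linarith
  have hE0 : 0 < E := by rw [hE]; linarith
  -- For `r₂ < r₁` the noise never produces a logarithm, since `γ ≥ 1`.
  have hαα : r₂ < r₁ → α₁ + 2 ≤ α₂ := fun h => by
    have : (r₂ : ℝ) + 1 ≤ r₁ := by exact_mod_cast h
    rw [hα₁, hα₂]; linarith
  have hββ : r₂ < r₁ → ∀ γ : ℝ, 1 ≤ γ → β₂ < γ * β₁ := fun h γ hγ => by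
    have h' : (r₂ : ℝ) < r₁ := by exact_mod_cast h
    have : β₂ < β₁ := by rw [hβ₁, hβ₂]; linarith
    nlinarith
  have hlow : r₂ < r₁ → 1 ≤ α₂ / (α₁ + 1) := fun h => by
    rw [le_div_iff₀ hα₁1]; linarith [hαα h]
  have hmid : r₂ < r₁ → 1 ≤ (α₂ + 1) / (α₁ + 1) := fun h => by
    rw [le_div_iff₀ hα₁1]; linarith [hαα h]
  refine ⟨fun f hf => summable_mixedDerivTerm hr₁ hr₂ hr hs hμ hf, ?_, ?_, ?_, ?_⟩
  · intro hrr δ₀ hδ₀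
    refine errorEstimate_of_log_le (κ := 1) (κ' := 1) (e := q - 1 / s) (g := 3 / 2 - 1 / s)
      hr₁ hr₂ hr hs hμ hp hq hE hα₁ hα₂ hβ₁ hβ₂ one_pos
      (Or.inr ⟨by rw [hα₁, hα₂, hrr]; ring, rfl⟩) (Or.inr ⟨by rw [hβ₁, hβ₂, hrr]; ring, rfl⟩)
      hβ₁0 hδ₀.le (fun _ _ _ => rfl) (fun δ hδ hδ1 => ?_)
      (fun B hB => log_factors_le hE0 hδ₀ hB zero_le_one zero_le_one (by linarith) (by linarith))
    have hL := log_one_div_pos hδ (hδ1.trans hδ₀)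
    rw [show 1 / s - q = -(q - 1 / s) by ring, Real.rpow_neg hL.le, ← div_eq_mul_inv]
  · intro hrr γ hγ
    have hγ' : 1 ≤ γ ∧ γ * α₁ < α₂ := by
      rcases hγ with (⟨h1, h2⟩ | ⟨h1, h2⟩) | ⟨h1, h2⟩
      · rw [lt_div_iff₀ hα₁1] at h2
        exact ⟨h1, by linarith⟩
      · rw [lt_div_iff₀ hα₁1] at h2
        have := hlow hrr
        exact ⟨by linarith, by linarith⟩
      · rw [lt_div_iff₀ hα₁0] at h2
        have := hmid hrr
        exact ⟨by linarith, h2⟩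
    exact errorEstimate_of_log_le (κ := 0) (κ' := 0) (e := 0) (g := 0)
      hr₁ hr₂ hr hs hμ hp hq hE hα₁ hα₂ hβ₁ hβ₂ (by linarith [hγ'.1])
      (Or.inl ⟨hγ'.2, rfl⟩) (Or.inl ⟨hββ hrr γ hγ'.1, rfl⟩)
      hβ₁0 le_rfl (fun _ _ _ => by simp) (fun _ _ _ => by simp)
      (fun B hB => ⟨1, one_pos, fun δ _ _ n _ _ => by simp⟩)
  · intro hrr γ hγ δ₀ hδ₀
    have hγ' : 1 ≤ γ ∧ ∃ κ : ℝ, 0 ≤ κ ∧ κ ≤ 1 ∧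
        ((γ * α₁ < α₂ ∧ κ = 0) ∨ (γ * α₁ = α₂ ∧ κ = 1)) := by
      rcases hγ with h | h
      · have h1 : 1 ≤ γ := h ▸ hlow hrr
        rw [eq_div_iff hα₁1.ne'] at h
        exact ⟨h1, 0, le_rfl, zero_le_one, Or.inl ⟨by linarith, rfl⟩⟩
      · have h1 : 1 ≤ γ := by
          rw [h, le_div_iff₀ hα₁0]
          linarith [hαα hrr]
        rw [eq_div_iff hα₁0.ne'] at h
        exact ⟨h1, 1, zero_le_one, le_rfl, Or.inr ⟨h, rfl⟩⟩
    obtain ⟨hγ1, κ, hκ0, hκ1, hκ⟩ := hγ'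
    refine errorEstimate_of_log_le (κ := κ) (κ' := 0) (e := 1 / 2) (g := 1 / 2)
      hr₁ hr₂ hr hs hμ hp hq hE hα₁ hα₂ hβ₁ hβ₂ (by linarith)
      hκ (Or.inl ⟨hββ hrr γ hγ1, rfl⟩)
      hβ₁0 hδ₀.le (fun δ hδ hδ1 => ?_) (fun _ _ _ => rfl)
      (fun B hB => log_factors_le hE0 hδ₀ hB hκ0 le_rfl (by linarith) (by linarith))
    have hL := log_one_div_pos hδ (hδ1.trans hδ₀)
    rw [Real.div_rpow hδ.le (by positivity), ← Real.rpow_mul hL.le,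
      show (1 / 2 : ℝ) * -(1 / E) = -(1 / (2 * E)) by field_simp, Real.rpow_neg hL.le,
      div_inv_eq_mul]
  · intro hrr γ hγ δ₀ hδ₀
    have hγ1 : 1 ≤ γ := hγ ▸ hmid hrr
    have hγ1' : γ * α₁ < α₂ := by
      have h1 : 1 < γ := by
        rw [hγ, lt_div_iff₀ hα₁1]
        linarith [hαα hrr]
      rw [eq_div_iff hα₁1.ne'] at hγ
      linarith
    exact errorEstimate_of_log_le (κ := 0) (κ' := 0) (e := 1 - 1 / s) (g := 1 - 1 / s)
      hr₁ hr₂ hr hs hμ hp hq hE hα₁ hα₂ hβ₁ hβ₂ (by linarith)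
      (Or.inl ⟨hγ1', rfl⟩) (Or.inl ⟨hββ hrr γ hγ1, rfl⟩)
      hβ₁0 hδ₀.le (fun _ _ _ => rfl) (fun _ _ _ => rfl)
      (fun B hB => log_factors_le hE0 hδ₀ hB le_rfl le_rfl (by linarith) (by linarith))
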